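/- Let $a,b>-1$ be real. Let $(\varphi_j)_{j\ge 0}$ be the orthonormal sequence obtained by applying Gram--Schmidt in $L^2[-1,1]$ to the functions $x^{j}(1-x)^{a/2}(1+x)^{b/2}$, $j=0,1,2,\dots$, and let $$K_N^{(2)}(x,y)=\sum_{j=0}^{N-1}\varphi_j(x)\varphi_j(y)$$ be the Christoffel--Darboux kernel of the Jacobi unitary ensemble with weight $(1-x)^a(1+x)^b$ on $[-1,1]$. Let $K_{\mathrm{sine}}(x,y)=\dfrac{\sin(x-y)}{\pi(x-y)}$ for $x\neq y$ and $K_{\mathrm{sine}}(x,x)=\dfrac1\pi$. Then, as $N\to\infty$, $$\frac1N K_N^{(2)}\!\left(\frac xN,\frac yN\right)=K_{\mathrm{sine}}(x,y)+O(N^{-1}),$$ uniformly for $x$ and $y$ in compact subsets of $\mathbb R$. That is, for every compact $K\subset\mathbb R$ there are a constant $C$ and an integer $N_0\ge 1$ (depending only on $a$, $b$ and $K$) such that for all $N\ge N_0$ and all $x,y\in K$, $$\left|\frac1N K_N^{(2)}\!\left(\frac xN,\frac yN\right)-K_{\mathrm{sine}}(x,y)\right|\le\frac CN .$$ -/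

import Mathlib

noncomputable section

/-- The inner product of `L²[-1,1]`, on real functions. -/
def innerL2 (f g : ℝ → ℝ) : ℝ := ∫ x in (-1 : ℝ)..1, f x * g x

/-- The function `x ↦ x ^ j (1 - x) ^ (a / 2) (1 + x) ^ (b / 2)` on `[-1,1]`. -/
def jacobiMonomial (a b : ℝ) (j : ℕ) (x : ℝ) : ℝ :=
  x ^ j * (1 - x) ^ (a / 2) * (1 + x) ^ (b / 2)

/-- The Gram-Schmidt orthogonalization (without normalization) of the sequence
`jacobiMonomial a b 0, jacobiMonomial a b 1, …` in `L²[-1,1]`. -/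
def jacobiOrthogonal (a b : ℝ) (n : ℕ) : ℝ → ℝ := fun x =>
  jacobiMonomial a b n x - ∑ k : Fin n,
    innerL2 (jacobiMonomial a b n) (jacobiOrthogonal a b k) /
      innerL2 (jacobiOrthogonal a b k) (jacobiOrthogonal a b k) * jacobiOrthogonal a b k x
termination_by n
decreasing_by all_goals exact k.2

/-- The orthonormal sequence `φ_j` obtained by Gram-Schmidt from the functions
`x ^ j (1 - x) ^ (a / 2) (1 + x) ^ (b / 2)` in `L²[-1,1]`. -/
def jacobiOrthonormal (a b : ℝ) (j : ℕ) (x : ℝ) : ℝ :=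
  jacobiOrthogonal a b j x / √(innerL2 (jacobiOrthogonal a b j) (jacobiOrthogonal a b j))

/-- The kernel `K_N(x, y) = ∑_{j < N} φ_j(x) φ_j(y)` of the Jacobi unitary ensemble. -/
def jueKernel (a b : ℝ) (N : ℕ) (x y : ℝ) : ℝ :=
  ∑ j ∈ Finset.range N, jacobiOrthonormal a b j x * jacobiOrthonormal a b j y

/-- The sine kernel, with its continuous extension `1 / π` on the diagonal. -/
def sineKernel (x y : ℝ) : ℝ :=
  if x = y then 1 / Real.pi else Real.sin (x - y) / (Real.pi * (x - y))

end

/-! By Christoffel–Darboux, the kernel is a Casorati determinant of two consecutive orthonormal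
Jacobi polynomials divided by `x - y`. At scale `1 / N` about the origin the Jacobi equation becomes
`f'' + f = O(1 / N)`, so each polynomial is `C¹`-close to a combination of `cos` and `sin`, and the
determinant is a constant times `sin (x - y)` with error `O(|x - y| / N)`
(`approx_of_perturbed_oscillator`, `casorati_approx`). The factor `|x - y|` in the error allows the
division; the diagonal follows by continuity, and the weight factors are `1 + O(1 / N)`.

It remains to show that the constant is `1 / π + O(1 / N)`, which needs the amplitude of the
polynomials at the origin. No known asymptotics of Jacobi polynomials are used; an energy identity
supplies the amplitude. In the variable `θ = arccos x` the function `u = √w (1 - x²)^(1/4) p` solves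
`u'' + (ν² + q) u = 0` with `ν = n + (a + b + 1) / 2` and `q` singular only at the endpoints.
Multiplying `u'² + (ν² + q) u²` by a primitive of `sin² θ` that vanishes at an endpoint, and
correcting by lower-order terms, gives an expression whose derivative is `2 ν² sin² θ u²` plus a
bounded multiple of `u²`. Integrating from both endpoints to the origin (`jacobiEnergyForm_zero`)
expresses the energy at `0` through the moment of `1 - x²` under `p² w`. That moment is computed
from the recurrence coefficients and tends to `1 / 2`, so `p(0)² + (p'(0) / ν)²` tends to `2 / π`
for orthonormal `p`.

Finally, the structure relation at `0` turns the derivatives into neighbouring values, whence two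
consecutive squared values sum to `2 / π + O(1 / n)` (`jacobi_sum_sq_isBigO`) and the constant is `1
/ π + O(1 / n)` (`jacobi_casorati_isBigO`). -/

open Polynomial

/-! ### Orthogonal polynomials of a positive linear functional. -/

section OrthogonalPolynomials

/-- The monic orthogonal polynomials of a linear functional, by Gram-Schmidt. -/
noncomputable def monicOrthogonal (L : ℝ[X] →ₗ[ℝ] ℝ) (n : ℕ) : ℝ[X] :=
  X ^ n - ∑ k : Fin n, (L (X ^ n * monicOrthogonal L k) /
    L (monicOrthogonal L k * monicOrthogonal L k)) • monicOrthogonal L k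
termination_by n
decreasing_by all_goals exact k.2

/-- The squared norm of the monic orthogonal polynomial. -/
noncomputable def orthogonalNormSq (L : ℝ[X] →ₗ[ℝ] ℝ) (n : ℕ) : ℝ :=
  L (monicOrthogonal L n * monicOrthogonal L n)

variable (L : ℝ[X] →ₗ[ℝ] ℝ)

theorem monicOrthogonal_coeff (n : ℕ) :
    (monicOrthogonal L n).coeff n = 1 ∧ ∀ m, n < m → (monicOrthogonal L n).coeff m = 0 := by
  induction n using Nat.strong_induction_on with
  | _ n ih =>
    have hs : ∀ m, n ≤ m → (∑ k : Fin n, (L (X ^ n * monicOrthogonal L k) /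
        L (monicOrthogonal L k * monicOrthogonal L k)) • monicOrthogonal L k).coeff m = 0 := by
      intro m hm
      rw [finsetSum_coeff]
      refine Finset.sum_eq_zero fun k _ => ?_
      rw [coeff_smul, (ih k k.2).2 m (lt_of_lt_of_le k.2 hm), smul_zero]
    rw [monicOrthogonal]
    refine ⟨?_, fun m hm => ?_⟩
    · rw [coeff_sub, hs n le_rfl]; simp
    · rw [coeff_sub, hs m hm.le, coeff_X_pow, if_neg hm.ne', sub_zero]

theorem monicOrthogonal_ne_zero (n : ℕ) : monicOrthogonal L n ≠ 0 := by
  intro h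
  have := (monicOrthogonal_coeff L n).1
  rw [h] at this
  simp at this

/-- A linear map killing `P_k` for `k < n` kills every polynomial of degree below `n`. -/
theorem linearMap_eq_zero_of_degree_lt (F : ℝ[X] →ₗ[ℝ] ℝ) (n : ℕ)
    (hF : ∀ k < n, F (monicOrthogonal L k) = 0) (q : ℝ[X]) (hq : ∀ m, n ≤ m → q.coeff m = 0) :
    F q = 0 := by
  induction n generalizing q with
  | zero =>
    have : q = 0 := by ext m; simpa using hq m (Nat.zero_le m)
    simp [this]
  | succ n ih =>
    have h := ih (fun k hk => hF k (hk.trans n.lt_succ_self)) (q - q.coeff n • monicOrthogonal L n)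
      (fun m hm => by
        rw [coeff_sub, coeff_smul, smul_eq_mul]
        rcases hm.eq_or_lt with rfl | hm
        · rw [(monicOrthogonal_coeff L n).1]; ring
        · rw [(monicOrthogonal_coeff L n).2 m hm, hq m hm]; ring)
    rw [map_sub, map_smul, hF n n.lt_succ_self] at h
    simpa using h

variable {L} (hpos : ∀ p : ℝ[X], p ≠ 0 → 0 < L (p * p))
include hpos

theorem orthogonalNormSq_pos (n : ℕ) : 0 < orthogonalNormSq L n :=
  hpos _ (monicOrthogonal_ne_zero L n)

theorem monicOrthogonal_orthogonal_of_lt (n : ℕ) :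
    ∀ k < n, L (monicOrthogonal L n * monicOrthogonal L k) = 0 := by
  induction n using Nat.strong_induction_on with
  | _ n ih =>
    intro k hk
    have key : L (monicOrthogonal L n * monicOrthogonal L k) = L (X ^ n * monicOrthogonal L k) -
        ∑ j : Fin n, (L (X ^ n * monicOrthogonal L j) /
          L (monicOrthogonal L j * monicOrthogonal L j)) *
          L (monicOrthogonal L j * monicOrthogonal L k) := by
      conv_lhs => rw [monicOrthogonal]
      rw [sub_mul, Finset.sum_mul, map_sub, map_sum]
      simp only [smul_mul_assoc, map_smul, smul_eq_mul]
    rw [key, Finset.sum_eq_single (⟨k, hk⟩ : Fin n)]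
    · have := orthogonalNormSq_pos hpos k
      unfold orthogonalNormSq at this
      field_simp
      ring
    · intro j _ hj
      have hjk : (j : ℕ) ≠ k := fun h => hj (Fin.ext h)
      rcases lt_or_gt_of_ne hjk with h | h
      · rw [mul_comm (monicOrthogonal L j) (monicOrthogonal L k), ih k hk j h, mul_zero]
      · rw [ih j j.2 k h, mul_zero]
    · simp

theorem monicOrthogonal_mul_eq_zero (n : ℕ) (q : ℝ[X]) (hq : ∀ m, n ≤ m → q.coeff m = 0) :
    L (monicOrthogonal L n * q) = 0 := by
  have := linearMap_eq_zero_of_degree_lt L (L ∘ₗ LinearMap.mulLeft ℝ (monicOrthogonal L n)) n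
    (fun k hk => by simpa using monicOrthogonal_orthogonal_of_lt hpos n k hk) q hq
  simpa using this

/-- For `q` of degree at most `n`, `L (P_n q)` is the leading coefficient times the norm. -/
theorem monicOrthogonal_mul_eq (n : ℕ) (q : ℝ[X]) (hq : ∀ m, n < m → q.coeff m = 0) :
    L (monicOrthogonal L n * q) = q.coeff n * orthogonalNormSq L n := by
  have := monicOrthogonal_mul_eq_zero hpos n (q - q.coeff n • monicOrthogonal L n) (fun m hm => by
    rw [coeff_sub, coeff_smul, smul_eq_mul]
    rcases hm.eq_or_lt with rfl | hm
    · rw [(monicOrthogonal_coeff L n).1]; ring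
    · rw [(monicOrthogonal_coeff L n).2 m hm, hq m hm]; ring)
  rw [mul_sub, mul_smul_comm, map_sub, map_smul, smul_eq_mul] at this
  unfold orthogonalNormSq
  linarith

/-- Such a `q` is a combination of the `P_k` with `k < n`, so `L (q * q) = 0` and positivity
applies. Polynomial identities below are proved this way: a degree count, then a test against each
lower `P_k`. -/
theorem eq_zero_of_orthogonal (n : ℕ) (q : ℝ[X]) (hq : ∀ m, n ≤ m → q.coeff m = 0)
    (h : ∀ k < n, L (monicOrthogonal L k * q) = 0) : q = 0 := by
  by_contra hne
  have := linearMap_eq_zero_of_degree_lt L (L ∘ₗ LinearMap.mulRight ℝ q) n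
    (fun k hk => by simpa using h k hk) q hq
  have h2 := hpos q hne
  simp at this
  linarith

/-- The three-term recurrence. -/
theorem monicOrthogonal_recurrence (n : ℕ) :
    X * monicOrthogonal L (n + 1) = monicOrthogonal L (n + 2) +
      C ((monicOrthogonal L (n + 1)).coeff n - (monicOrthogonal L (n + 2)).coeff (n + 1)) *
        monicOrthogonal L (n + 1) +
      C (orthogonalNormSq L (n + 1) / orthogonalNormSq L n) * monicOrthogonal L n := by
  set β := (monicOrthogonal L (n + 1)).coeff n - (monicOrthogonal L (n + 2)).coeff (n + 1)
  have hc := monicOrthogonal_coeff L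
  have hn := orthogonalNormSq_pos hpos n
  rw [← sub_eq_zero]
  -- `β` is chosen to cancel the coefficient of `X ^ (n + 1)`, so only `k ≤ n` has to be tested and
  -- `L (X * P_(n+1) ^ 2)` is never computed.
  refine eq_zero_of_orthogonal hpos (n + 1) _ (fun m hm => ?_) (fun k hk => ?_)
  · obtain ⟨m, rfl⟩ : ∃ j, m = j + 1 := ⟨m - 1, by omega⟩
    have hm' : n ≤ m := by omega
    simp only [coeff_sub, coeff_add, coeff_X_mul, coeff_C_mul]
    rw [(hc n).2 (m + 1) (by omega)]
    rcases hm'.eq_or_lt with rfl | hm1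
    · rw [(hc (n + 1)).1]; simp only [β]; ring
    · rw [(hc (n + 1)).2 (m + 1) (by omega)]
      rcases (Nat.succ_le_of_lt hm1).eq_or_lt with rfl | hm2
      · rw [(hc (n + 1)).1, (hc (n + 2)).1]; ring
      · rw [(hc (n + 1)).2 m (by omega), (hc (n + 2)).2 (m + 1) (by omega)]; ring
  · have e1 : L (monicOrthogonal L k * monicOrthogonal L (n + 2)) = 0 := by
      rw [mul_comm]; exact monicOrthogonal_orthogonal_of_lt hpos _ k (by omega)
    have e2 : L (monicOrthogonal L k * monicOrthogonal L (n + 1)) = 0 := by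
      rw [mul_comm]; exact monicOrthogonal_orthogonal_of_lt hpos _ k (by omega)
    have e3 : L (monicOrthogonal L k * (X * monicOrthogonal L (n + 1))) =
        (if k = n then 1 else 0) * orthogonalNormSq L (n + 1) := by
      rw [← mul_assoc, mul_comm, monicOrthogonal_mul_eq hpos (n + 1), mul_comm _ X, coeff_X_mul]
      · split_ifs with h
        · rw [h, (hc n).1]
        · rw [(hc k).2 n (by omega)]
      · intro m hm
        obtain ⟨m, rfl⟩ : ∃ j, m = j + 1 := ⟨m - 1, by omega⟩
        rw [mul_comm _ X, coeff_X_mul, (hc k).2 m (by omega)]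
    have e4 : L (monicOrthogonal L k * monicOrthogonal L n) =
        (if k = n then 1 else 0) * orthogonalNormSq L n := by
      split_ifs with h
      · rw [h, one_mul, orthogonalNormSq]
      · rw [mul_comm, monicOrthogonal_orthogonal_of_lt hpos _ k (by omega), zero_mul]
    rw [mul_sub, mul_add, mul_add, map_sub, map_add, map_add, e1, e3, ← smul_eq_C_mul,
      ← smul_eq_C_mul, mul_smul_comm, mul_smul_comm, map_smul, map_smul, e2, e4]
    simp only [smul_eq_mul]
    field_simp
    ring

/-- The Christoffel-Darboux formula. -/
theorem christoffel_darboux (n : ℕ) (x y : ℝ) :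
    (∑ j ∈ Finset.range (n + 1), (monicOrthogonal L j).eval x * (monicOrthogonal L j).eval y /
      orthogonalNormSq L j) * (x - y) =
    ((monicOrthogonal L (n + 1)).eval x * (monicOrthogonal L n).eval y -
      (monicOrthogonal L n).eval x * (monicOrthogonal L (n + 1)).eval y) /
      orthogonalNormSq L n := by
  induction n with
  | zero =>
    have h0 : monicOrthogonal L 0 = 1 := by rw [monicOrthogonal]; simp
    have h1 : monicOrthogonal L 1 = X + C ((monicOrthogonal L 1).coeff 0) := by
      have hc := monicOrthogonal_coeff L 1
      ext m
      rcases m with _ | _ | m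
      · simp
      · rw [hc.1]; simp [coeff_X]
      · rw [hc.2 _ (by omega)]; simp [coeff_X]
    simp only [zero_add, Finset.sum_range_one, h0, eval_one]
    rw [h1]
    simp
    ring
  | succ n ih =>
    rw [Finset.sum_range_succ, add_mul, ih]
    have hn := (orthogonalNormSq_pos hpos n).ne'
    have hn1 := (orthogonalNormSq_pos hpos (n + 1)).ne'
    have hx := congrArg (eval x) (monicOrthogonal_recurrence hpos n)
    have hy := congrArg (eval y) (monicOrthogonal_recurrence hpos n)
    simp only [eval_mul, eval_add, eval_X, eval_C] at hx hy
    field_simp at hx hy ⊢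
    -- Cross-multiplying the recurrences at `x` and `y` eliminates the diagonal coefficient.
    linear_combination (monicOrthogonal L (n + 1)).eval y * hx -
      (monicOrthogonal L (n + 1)).eval x * hy

/-- The second moment of the orthonormal polynomials. -/
theorem orthogonal_second_moment (n : ℕ) :
    L ((1 - X ^ 2) * (monicOrthogonal L (n + 1) * monicOrthogonal L (n + 1))) =
      orthogonalNormSq L (n + 1) * (1 - orthogonalNormSq L (n + 2) / orthogonalNormSq L (n + 1) -
        ((monicOrthogonal L (n + 1)).coeff n - (monicOrthogonal L (n + 2)).coeff (n + 1)) ^ 2 -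
        orthogonalNormSq L (n + 1) / orthogonalNormSq L n) := by
  set β := (monicOrthogonal L (n + 1)).coeff n - (monicOrthogonal L (n + 2)).coeff (n + 1) with hβ
  have hrec := monicOrthogonal_recurrence hpos n
  rw [← hβ] at hrec
  have hn := orthogonalNormSq_pos hpos n
  have hn1 := orthogonalNormSq_pos hpos (n + 1)
  -- With `X² P²` written as `(X P)²`, the recurrence expands both factors and orthogonality keeps
  -- only the three diagonal terms.
  have : (1 - X ^ 2) * (monicOrthogonal L (n + 1) * monicOrthogonal L (n + 1)) =
      monicOrthogonal L (n + 1) * monicOrthogonal L (n + 1) -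
      (X * monicOrthogonal L (n + 1)) * (X * monicOrthogonal L (n + 1)) := by ring
  have horth := monicOrthogonal_orthogonal_of_lt hpos
  have o1 := horth (n + 2) (n + 1) (by omega)
  have o2 := horth (n + 2) n (by omega)
  have o3 := horth (n + 1) n (by omega)
  rw [this, hrec]
  simp only [← smul_eq_C_mul, mul_add, add_mul, mul_smul_comm, smul_mul_assoc, map_sub, map_add,
    map_smul, smul_eq_mul]
  rw [mul_comm (monicOrthogonal L (n + 1)) (monicOrthogonal L (n + 2)),
    mul_comm (monicOrthogonal L n) (monicOrthogonal L (n + 2)),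
    mul_comm (monicOrthogonal L n) (monicOrthogonal L (n + 1)), o1, o2, o3]
  have f (k : ℕ) : L (monicOrthogonal L k * monicOrthogonal L k) = orthogonalNormSq L k := rfl
  rw [f, f, f]
  field_simp
  ring

end OrthogonalPolynomials

/-! ### Differential equation, structure relation and recurrence coefficients from the Pearson
equation. -/

section JacobiAlgebra

/-- The Jacobi differential operator `(1 - x²) p'' + (b - a - (a + b + 2) x) p'`. -/
noncomputable def jacobiOperator (a b : ℝ) (p : ℝ[X]) : ℝ[X] :=
  (1 - X ^ 2) * derivative (derivative p) + (C (b - a) - C (a + b + 2) * X) * derivative p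

/-- The operator does not raise degrees and has diagonal entries `-k (k + a + b + 1)` on monomials;
the eigenvalues and the top coefficients of the `P_n` are read off from this. -/
theorem jacobiOperator_coeff (a b : ℝ) (p : ℝ[X]) (k : ℕ) :
    (jacobiOperator a b p).coeff k = (k + 2) * (k + 1) * p.coeff (k + 2) +
      (b - a) * (k + 1) * p.coeff (k + 1) - k * (k + a + b + 1) * p.coeff k := by
  have h1 : ∀ q : ℝ[X], ∀ k : ℕ, ((C (b - a) - C (a + b + 2) * X) * derivative q).coeff k =
      (b - a) * (k + 1) * q.coeff (k + 1) - (a + b + 2) * k * q.coeff k := by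
    intro q k
    rw [sub_mul, coeff_sub, coeff_C_mul, mul_assoc, coeff_C_mul, coeff_derivative]
    rcases k with _ | k
    · simp
    · rw [coeff_X_mul, coeff_derivative]; push_cast; ring
  have h2 : ((1 - X ^ 2) * derivative (derivative p)).coeff k =
      (k + 2) * (k + 1) * p.coeff (k + 2) - k * (k - 1) * p.coeff k := by
    rw [sub_mul, coeff_sub, one_mul, coeff_derivative, coeff_derivative]
    rcases k with _ | _ | k
    · simp; ring
    · simp [pow_two, mul_assoc]; ring
    · rw [show k + 1 + 1 = k + 2 from rfl, coeff_X_pow_mul, coeff_derivative, coeff_derivative]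
      push_cast; ring
  rw [jacobiOperator, coeff_add, h1, h2]
  ring

variable {a b : ℝ} {L : ℝ[X] →ₗ[ℝ] ℝ} (hpos : ∀ p : ℝ[X], p ≠ 0 → 0 < L (p * p))
  (hL : ∀ r : ℝ[X], L ((1 - X ^ 2) * derivative r + (C (b - a) - C (a + b + 2) * X) * r) = 0)

include hL in
-- Lagrange's identity: the difference of the two arguments is the Pearson expression of `q p' - p
-- q'`, which `L` kills.
theorem jacobiOperator_symm (p q : ℝ[X]) :
    L (q * jacobiOperator a b p) = L (p * jacobiOperator a b q) := by
  have h1 := hL (q * derivative p)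
  have h2 := hL (p * derivative q)
  rw [← sub_eq_zero, ← map_sub]
  have : q * jacobiOperator a b p - p * jacobiOperator a b q =
      ((1 - X ^ 2) * derivative (q * derivative p) +
        (C (b - a) - C (a + b + 2) * X) * (q * derivative p)) -
      ((1 - X ^ 2) * derivative (p * derivative q) +
        (C (b - a) - C (a + b + 2) * X) * (p * derivative q)) := by
    simp only [jacobiOperator, derivative_mul]
    ring
  rw [this, map_sub, h1, h2, sub_zero]

include hpos hL

/-- The Jacobi differential equation. -/
theorem jacobiOperator_monicOrthogonal (n : ℕ) :
    jacobiOperator a b (monicOrthogonal L n) =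
      -(C (n * (n + a + b + 1)) * monicOrthogonal L n) := by
  have hc := monicOrthogonal_coeff L
  rw [← sub_eq_zero, sub_neg_eq_add]
  refine eq_zero_of_orthogonal hpos n _ (fun m hm => ?_) (fun k hk => ?_)
  · rw [coeff_add, jacobiOperator_coeff, coeff_C_mul, (hc n).2 (m + 2) (by omega),
      (hc n).2 (m + 1) (by omega)]
    rcases hm.eq_or_lt with rfl | hm
    · ring
    · rw [(hc n).2 m hm]; ring
  -- Symmetry moves the operator onto `P_k`, whose image still has degree at most `k < n`.
  · rw [mul_add, map_add, jacobiOperator_symm hL, ← smul_eq_C_mul, mul_smul_comm, map_smul,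
      mul_comm (monicOrthogonal L k), monicOrthogonal_orthogonal_of_lt hpos n k hk,
      monicOrthogonal_mul_eq_zero hpos, smul_zero, add_zero]
    intro m hm
    rw [jacobiOperator_coeff, (hc k).2 _ (by omega), (hc k).2 _ (by omega), (hc k).2 _ (by omega)]
    ring

/-- The structure relation. -/
theorem jacobi_structure (n : ℕ) :
    (1 - X ^ 2) * derivative (monicOrthogonal L (n + 1)) =
      -(C (n + 1 : ℝ) * monicOrthogonal L (n + 2)) +
      C (((a + b + 2) * ((monicOrthogonal L (n + 1)).coeff n -
        (monicOrthogonal L (n + 2)).coeff (n + 1)) + a - b) / 2) * monicOrthogonal L (n + 1) +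
      C ((n + a + b + 2) * (orthogonalNormSq L (n + 1) / orthogonalNormSq L n)) *
        monicOrthogonal L n := by
  set β := (monicOrthogonal L (n + 1)).coeff n - (monicOrthogonal L (n + 2)).coeff (n + 1) with hβ
  have hc := monicOrthogonal_coeff L
  have hrec := monicOrthogonal_recurrence hpos n
  rw [← hβ] at hrec
  have hn := orthogonalNormSq_pos hpos n
  -- coefficients of `(1 - x²) p'` and of `τ q + (1 - x²) q'`
  have hs : ∀ (p : ℝ[X]) (k : ℕ), ((1 - X ^ 2) * derivative p).coeff (k + 1) =
      (k + 2) * p.coeff (k + 2) - k * p.coeff k := by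
    intro p k
    rw [sub_mul, coeff_sub, one_mul, coeff_derivative]
    rcases k with _ | k
    · simp [pow_two, mul_assoc]; ring
    · rw [show k + 1 + 1 = k + 2 from rfl, coeff_X_pow_mul, coeff_derivative]; push_cast; ring
  have ht : ∀ (q : ℝ[X]) (k : ℕ), ((C (b - a) - C (a + b + 2) * X) * q).coeff (k + 1) =
      (b - a) * q.coeff (k + 1) - (a + b + 2) * q.coeff k := by
    intro q k
    rw [sub_mul, coeff_sub, coeff_C_mul, mul_assoc, coeff_C_mul, coeff_X_mul]
  -- Integration by parts. For `q = P_k` the right-hand factor has degree at most `k + 1`, so only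
  -- `k = n` and `k = n + 1` survive.
  have hparts : ∀ q : ℝ[X], L (q * ((1 - X ^ 2) * derivative (monicOrthogonal L (n + 1)))) =
      -L (monicOrthogonal L (n + 1) *
        ((1 - X ^ 2) * derivative q + (C (b - a) - C (a + b + 2) * X) * q)) := by
    intro q
    have := hL (monicOrthogonal L (n + 1) * q)
    rw [eq_neg_iff_add_eq_zero, ← map_add, ← this]
    congr 1
    rw [derivative_mul]
    ring
  have horth : ∀ j k : ℕ, j ≠ k → L (monicOrthogonal L j * monicOrthogonal L k) = 0 := by
    intro j k hjk
    rcases lt_or_gt_of_ne hjk with h | h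
    · rw [mul_comm]; exact monicOrthogonal_orthogonal_of_lt hpos k j h
    · exact monicOrthogonal_orthogonal_of_lt hpos j k h
  rw [← sub_eq_zero]
  refine eq_zero_of_orthogonal hpos (n + 2) _ (fun m hm => ?_) (fun k hk => ?_)
  · obtain ⟨m, rfl⟩ : ∃ j, m = j + 1 := ⟨m - 1, by omega⟩
    have hm' : n + 1 ≤ m := by omega
    rw [coeff_sub, hs]
    simp only [coeff_add, coeff_neg, coeff_C_mul]
    rw [(hc n).2 (m + 1) (by omega), (hc (n + 1)).2 (m + 2) (by omega),
      (hc (n + 1)).2 (m + 1) (by omega)]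
    rcases hm'.eq_or_lt with rfl | hm1
    · rw [(hc (n + 1)).1, (hc (n + 2)).1]; push_cast; ring
    · rw [(hc (n + 1)).2 m (by omega), (hc (n + 2)).2 (m + 1) (by omega)]; ring
  · have e0 : L (monicOrthogonal L k * ((1 - X ^ 2) * derivative (monicOrthogonal L (n + 1)))) =
        (if k = n + 1 then ((a + b + 2) * β + a - b) / 2 else if k = n then (n + a + b + 2) else 0)
          * orthogonalNormSq L (n + 1) := by
      split_ifs with h h'
      · subst h
        -- Here the unknown occurs on both sides with opposite signs; solving for it produces the
        -- factor `1 / 2`.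
        have h3 := hparts (monicOrthogonal L (n + 1))
        rw [mul_add, map_add] at h3
        have h4 : L (monicOrthogonal L (n + 1) *
            ((C (b - a) - C (a + b + 2) * X) * monicOrthogonal L (n + 1))) =
            ((b - a) - (a + b + 2) * β) * orthogonalNormSq L (n + 1) := by
          rw [sub_mul, mul_assoc (C (a + b + 2)), hrec, ← smul_eq_C_mul, ← smul_eq_C_mul,
            ← smul_eq_C_mul, ← smul_eq_C_mul]
          simp only [mul_sub, mul_add, mul_smul_comm, smul_add, map_sub, map_add, map_smul,
            smul_eq_mul]
          rw [horth (n + 1) (n + 2) (by omega), horth (n + 1) n (by omega), orthogonalNormSq]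
          ring
        rw [h4] at h3
        linarith
      · subst h'
        rw [hparts, monicOrthogonal_mul_eq hpos (k + 1), coeff_add, hs, ht, (hc k).1,
          (hc k).2 (k + 1) (by omega), (hc k).2 (k + 2) (by omega)]
        · ring
        · intro m hm
          obtain ⟨m, rfl⟩ : ∃ j, m = j + 1 := ⟨m - 1, by omega⟩
          rw [coeff_add, hs, ht, (hc k).2 m (by omega),
            (hc k).2 (m + 1) (by omega), (hc k).2 (m + 2) (by omega)]
          ring
      · rw [hparts, monicOrthogonal_mul_eq_zero hpos]
        · ring
        · intro m hm
          obtain ⟨m, rfl⟩ : ∃ j, m = j + 1 := ⟨m - 1, by omega⟩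
          rw [coeff_add, hs, ht, (hc k).2 m (by omega),
            (hc k).2 (m + 1) (by omega), (hc k).2 (m + 2) (by omega)]
          ring
    rw [mul_sub, map_sub, e0]
    generalize (n + 1 : ℝ) = c at *
    simp only [← smul_eq_C_mul, mul_add, mul_neg, mul_smul_comm, map_add, map_neg, map_smul,
      smul_eq_mul]
    rw [horth k (n + 2) (by omega)]
    split_ifs with h h'
    · subst h
      rw [horth (n + 1) n (by omega), orthogonalNormSq]; ring
    · subst h'
      rw [horth k (k + 1) (by omega), ← orthogonalNormSq]
      field_simp; ring
    · rw [horth k (n + 1) h, horth k n h']; ring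

variable (ha : -1 < a) (hb : -1 < b)
include ha hb

/-- The coefficient of `X ^ n` in the differential equation is a linear equation for the unknown.
Its pivot is the gap `2 n + a + b + 2` between consecutive eigenvalues, positive because `a, b >
-1`. -/
theorem monicOrthogonal_subleading (n : ℕ) :
    (monicOrthogonal L (n + 1)).coeff n = (n + 1) * (a - b) / (2 * n + a + b + 2) := by
  have h := congrArg (fun p => coeff p n) (jacobiOperator_monicOrthogonal hpos hL (n + 1))
  have hc := monicOrthogonal_coeff L (n + 1)
  simp only [jacobiOperator_coeff, coeff_neg, coeff_C_mul] at h
  rw [hc.1, hc.2 _ (by omega)] at h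
  have hn : (0 : ℝ) ≤ n := n.cast_nonneg
  rw [eq_div_iff (by linarith)]
  push_cast at h
  linear_combination h

theorem monicOrthogonal_subsubleading (n : ℕ) :
    (monicOrthogonal L (n + 2)).coeff n = -((n + 1) * ((n + 2) + (b - a) *
      (monicOrthogonal L (n + 2)).coeff (n + 1))) / (2 * (2 * n + a + b + 3)) := by
  have h := congrArg (fun p => coeff p n) (jacobiOperator_monicOrthogonal hpos hL (n + 2))
  have hc := monicOrthogonal_coeff L (n + 2)
  simp only [jacobiOperator_coeff, coeff_neg, coeff_C_mul] at h
  rw [hc.1] at h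
  have hn : (0 : ℝ) ≤ n := n.cast_nonneg
  rw [eq_div_iff (by linarith)]
  push_cast at h
  linear_combination h

theorem jacobi_recurrence_diag (n : ℕ) :
    (monicOrthogonal L (n + 1)).coeff n - (monicOrthogonal L (n + 2)).coeff (n + 1) =
      (b - a) * (a + b) / ((2 * n + a + b + 2) * (2 * n + a + b + 4)) := by
  rw [monicOrthogonal_subleading hpos hL ha hb n, monicOrthogonal_subleading hpos hL ha hb (n + 1)]
  have hn : (0 : ℝ) ≤ n := n.cast_nonneg
  obtain ⟨D, hD⟩ : ∃ D, D = 2 * (n : ℝ) + a + b + 2 := ⟨_, rfl⟩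
  have h1 : D ≠ 0 := by linarith
  have h2 : D + 2 ≠ 0 := by linarith
  rw [show 2 * ((n + 1 : ℕ) : ℝ) + a + b + 2 = D + 2 by push_cast; linarith,
    show 2 * (n : ℝ) + a + b + 4 = D + 2 by linarith, ← hD]
  push_cast
  rw [show (n : ℝ) = (D - a - b - 2) / 2 by linarith]
  field_simp
  ring

/-- The ratio is a recurrence coefficient, hence determined by the top three coefficients of
consecutive `P_k`. Starting at `h_2 / h_1` keeps the denominators positive: at `n = -1` the formula
would contain `a + b + 1`, which may vanish. -/
theorem orthogonalNormSq_ratio (n : ℕ) :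
    orthogonalNormSq L (n + 2) / orthogonalNormSq L (n + 1) =
      4 * (n + 2) * (n + 2 + a) * (n + 2 + b) * (n + 2 + a + b) /
        ((2 * n + a + b + 4) ^ 2 * (2 * n + a + b + 5) * (2 * n + a + b + 3)) := by
  have h := congrArg (fun p => coeff p (n + 1)) (monicOrthogonal_recurrence hpos (n + 1))
  have hc := monicOrthogonal_coeff L
  simp only [coeff_add, coeff_C_mul, coeff_X_mul] at h
  rw [(hc (n + 1)).1] at h
  have e1 := monicOrthogonal_subleading hpos hL ha hb (n + 1)
  have e2 := monicOrthogonal_subleading hpos hL ha hb (n + 2)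
  have e3 := monicOrthogonal_subsubleading hpos hL ha hb n
  have e4 := monicOrthogonal_subsubleading hpos hL ha hb (n + 1)
  have h' : orthogonalNormSq L (n + 2) / orthogonalNormSq L (n + 1) =
      (monicOrthogonal L (n + 2)).coeff n - (monicOrthogonal L (n + 3)).coeff (n + 1) -
      ((monicOrthogonal L (n + 2)).coeff (n + 1) - (monicOrthogonal L (n + 3)).coeff (n + 2)) *
        (monicOrthogonal L (n + 2)).coeff (n + 1) := by linear_combination -h
  rw [h', e3, e4, e2, e1]
  have hn : (0 : ℝ) ≤ n := n.cast_nonneg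
  obtain ⟨D, hD⟩ : ∃ D, D = 2 * (n : ℝ) + a + b + 4 := ⟨_, rfl⟩
  have h1 : D - 1 ≠ 0 := by linarith
  have h2 : D ≠ 0 := by linarith
  have h3 : D + 1 ≠ 0 := by linarith
  have h4 : D + 2 ≠ 0 := by linarith
  rw [show 2 * ((n + 1 : ℕ) : ℝ) + a + b + 2 = D by push_cast; linarith,
    show 2 * ((n + 2 : ℕ) : ℝ) + a + b + 2 = D + 2 by push_cast; linarith,
    show 2 * ((n + 1 : ℕ) : ℝ) + a + b + 3 = D + 1 by push_cast; linarith,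
    show 2 * (n : ℝ) + a + b + 5 = D + 1 by linarith,
    show 2 * (n : ℝ) + a + b + 3 = D - 1 by linarith, ← hD]
  push_cast
  rw [show (n : ℝ) = (D - a - b - 4) / 2 by linarith]
  field_simp
  ring

end JacobiAlgebra

/-! ### The Jacobi weight, its functional, and the kernel in terms of polynomials. -/

section JacobiWeight

open MeasureTheory Set

/-- The Jacobi weight `(1 - x) ^ a (1 + x) ^ b`. -/
noncomputable def jacobiWeight (a b x : ℝ) : ℝ := (1 - x) ^ a * (1 + x) ^ b

theorem jacobiWeight_pos {a b x : ℝ} (hx : x ∈ Ioo (-1 : ℝ) 1) : 0 < jacobiWeight a b x :=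
  mul_pos (Real.rpow_pos_of_pos (by linarith [hx.2]) _)
    (Real.rpow_pos_of_pos (by linarith [hx.1]) _)

theorem hasDerivAt_jacobiWeight (a b : ℝ) {x : ℝ} (hx : x ∈ Ioo (-1 : ℝ) 1) :
    HasDerivAt (jacobiWeight a b)
      (jacobiWeight a b x * (((b - a) - (a + b) * x) / (1 - x ^ 2))) x := by
  have h1 : 0 < 1 - x := by linarith [hx.2]
  have h2 : 0 < 1 + x := by linarith [hx.1]
  have e : HasDerivAt (jacobiWeight a b) _ x :=
    (((hasDerivAt_id x).const_sub 1).rpow_const (p := a) (Or.inl h1.ne')).mul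
      (((hasDerivAt_id x).const_add 1).rpow_const (p := b) (Or.inl h2.ne'))
  convert e using 1
  simp only [id, jacobiWeight]
  rw [Real.rpow_sub_one h1.ne', Real.rpow_sub_one h2.ne',
    show 1 - x ^ 2 = (1 - x) * (1 + x) by ring]
  field_simp
  ring

theorem intervalIntegrable_jacobiWeight {a b : ℝ} (ha : -1 < a) (hb : -1 < b) :
    IntervalIntegrable (jacobiWeight a b) volume (-1) 1 := by
  refine IntervalIntegrable.trans (b := 0) ?_ ?_
  · have h : IntervalIntegrable (fun x : ℝ => (1 + x) ^ b) volume (-1) 0 := by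
      have := (intervalIntegral.intervalIntegrable_rpow' (a := 0) (b := 1) hb).comp_add_left 1
      simpa using this
    refine h.continuousOn_mul ?_
    refine ContinuousOn.rpow_const (by fun_prop) fun x hx => Or.inl ?_
    rw [uIcc_of_le (by norm_num)] at hx
    linarith [hx.2]
  · have h : IntervalIntegrable (fun x : ℝ => (1 - x) ^ a) volume 0 1 := by
      have := (intervalIntegral.intervalIntegrable_rpow' (a := 1) (b := 0) ha).comp_sub_left 1
      simpa using this
    refine h.mul_continuousOn ?_
    refine ContinuousOn.rpow_const (by fun_prop) fun x hx => Or.inl ?_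
    rw [uIcc_of_le (by norm_num)] at hx
    linarith [hx.1]

theorem intervalIntegrable_eval_mul_jacobiWeight {a b : ℝ} (ha : -1 < a) (hb : -1 < b)
    (p : ℝ[X]) : IntervalIntegrable (fun x => p.eval x * jacobiWeight a b x) volume (-1) 1 :=
  (intervalIntegrable_jacobiWeight ha hb).continuousOn_mul p.continuous.continuousOn

/-- Integration of polynomials against the Jacobi weight. -/
noncomputable def jacobiFunctional {a b : ℝ} (ha : -1 < a) (hb : -1 < b) : ℝ[X] →ₗ[ℝ] ℝ where
  toFun p := ∫ x in (-1 : ℝ)..1, p.eval x * jacobiWeight a b x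
  map_add' p q := by
    simp only [eval_add, add_mul]
    exact intervalIntegral.integral_add (intervalIntegrable_eval_mul_jacobiWeight ha hb p)
      (intervalIntegrable_eval_mul_jacobiWeight ha hb q)
  map_smul' c p := by
    simp only [eval_smul, smul_eq_mul, mul_assoc, intervalIntegral.integral_const_mul,
      RingHom.id_apply]

theorem jacobiFunctional_apply {a b : ℝ} (ha : -1 < a) (hb : -1 < b) (p : ℝ[X]) :
    jacobiFunctional ha hb p = ∫ x in (-1 : ℝ)..1, p.eval x * jacobiWeight a b x := rfl

/-- The Pearson equation of the Jacobi weight, in integrated form. -/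
theorem jacobiFunctional_pearson {a b : ℝ} (ha : -1 < a) (hb : -1 < b) (r : ℝ[X]) :
    jacobiFunctional ha hb
      ((1 - X ^ 2) * derivative r + (C (b - a) - C (a + b + 2) * X) * r) = 0 := by
  rw [jacobiFunctional_apply]
  rw [intervalIntegral.integral_eq_sub_of_hasDerivAt_of_le (by norm_num)
    -- This antiderivative vanishes at both endpoints because `a + 1` and `b + 1` are positive.
    (f := fun x => (1 - x) ^ (a + 1) * (1 + x) ^ (b + 1) * r.eval x)]
  · simp [Real.zero_rpow (show a + 1 ≠ 0 by linarith), Real.zero_rpow (show b + 1 ≠ 0 by linarith)]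
  · refine ContinuousOn.mul (ContinuousOn.mul ?_ ?_) r.continuous.continuousOn
    · exact ContinuousOn.rpow_const (by fun_prop) fun x hx => Or.inr (by linarith)
    · exact ContinuousOn.rpow_const (by fun_prop) fun x hx => Or.inr (by linarith)
  · intro x hx
    have h1 : 0 < 1 - x := by linarith [hx.2]
    have h2 : 0 < 1 + x := by linarith [hx.1]
    have e : HasDerivAt (fun x => (1 - x) ^ (a + 1) * (1 + x) ^ (b + 1) * r.eval x) _ x :=
      ((((hasDerivAt_id x).const_sub 1).rpow_const (p := a + 1) (Or.inl h1.ne')).mul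
      (((hasDerivAt_id x).const_add 1).rpow_const (p := b + 1) (Or.inl h2.ne'))).mul
      (r.hasDerivAt x)
    refine e.congr_deriv ?_
    simp only [id, jacobiWeight, eval_add, eval_mul, eval_sub, eval_one, eval_pow, eval_X, eval_C,
      Pi.mul_apply, add_sub_cancel_right]
    rw [Real.rpow_add_one h1.ne', Real.rpow_add_one h2.ne']
    ring
  · exact intervalIntegrable_eval_mul_jacobiWeight ha hb _

/-- The integrand is nonnegative and vanishes inside the interval only at the finitely many roots of
`p`. -/
theorem jacobiFunctional_pos {a b : ℝ} (ha : -1 < a) (hb : -1 < b) (p : ℝ[X]) (hp : p ≠ 0) :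
    0 < jacobiFunctional ha hb (p * p) := by
  rw [jacobiFunctional_apply,
    intervalIntegral.integral_pos_iff_support_of_nonneg_ae' ?_
      (intervalIntegrable_eval_mul_jacobiWeight ha hb _)]
  · refine ⟨by norm_num, ?_⟩
    have hsub : Ioo (-1 : ℝ) 1 \ (p.roots.toFinset : Set ℝ) ⊆
        (Function.support fun x => (p * p).eval x * jacobiWeight a b x) ∩ Ioc (-1) 1 := by
      rintro x ⟨hx, hxr⟩
      refine ⟨?_, hx.1, hx.2.le⟩
      have : p.eval x ≠ 0 := by simpa [hp] using hxr
      simp [this, (jacobiWeight_pos hx).ne']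
    refine lt_of_lt_of_le ?_ (measure_mono hsub)
    rw [measure_sdiff_null (Finset.measure_zero _ _)]
    simp
  · rw [uIoc_of_le (by norm_num)]
    refine (ae_restrict_iff' measurableSet_Ioc).2 (Filter.Eventually.of_forall fun x hx => ?_)
    change 0 ≤ (p * p).eval x * jacobiWeight a b x
    rw [eval_mul]
    exact mul_nonneg (mul_self_nonneg _) (mul_nonneg (Real.rpow_nonneg (by linarith [hx.2]) _)
      (Real.rpow_nonneg (by linarith [hx.1]) _))

theorem innerL2_eval_mul_jacobiWeight {a b : ℝ} (ha : -1 < a) (hb : -1 < b) (p q : ℝ[X]) :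
    innerL2 (fun x => p.eval x * jacobiWeight (a / 2) (b / 2) x)
      (fun x => q.eval x * jacobiWeight (a / 2) (b / 2) x) = jacobiFunctional ha hb (p * q) := by
  rw [innerL2, jacobiFunctional_apply, intervalIntegral.integral_of_le (by norm_num),
    intervalIntegral.integral_of_le (by norm_num), integral_Ioc_eq_integral_Ioo,
    integral_Ioc_eq_integral_Ioo]
  refine setIntegral_congr_fun measurableSet_Ioo fun x hx => ?_
  have h1 : 0 < 1 - x := by linarith [hx.2]
  have h2 : 0 < 1 + x := by linarith [hx.1]
  have e1 : (1 - x) ^ a = (1 - x) ^ (a / 2) * (1 - x) ^ (a / 2) := by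
    rw [← Real.rpow_add h1]; ring_nf
  have e2 : (1 + x) ^ b = (1 + x) ^ (b / 2) * (1 + x) ^ (b / 2) := by
    rw [← Real.rpow_add h2]; ring_nf
  simp only [jacobiWeight, eval_mul]
  rw [e1, e2]
  ring

/-- The square root of the weight factors out of every Gram–Schmidt step, and its square is absorbed
into the functional. -/
theorem jacobiOrthogonal_eq {a b : ℝ} (ha : -1 < a) (hb : -1 < b) (n : ℕ) :
    jacobiOrthogonal a b n = fun x =>
      (monicOrthogonal (jacobiFunctional ha hb) n).eval x * jacobiWeight (a / 2) (b / 2) x := by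
  induction n using Nat.strong_induction_on with
  | _ n ih =>
    have hm : jacobiMonomial a b n =
        fun x => (X ^ n : ℝ[X]).eval x * jacobiWeight (a / 2) (b / 2) x := by
      ext x; simp [jacobiMonomial, jacobiWeight, mul_assoc]
    ext x
    rw [jacobiOrthogonal, monicOrthogonal, eval_sub, sub_mul, eval_finsetSum, Finset.sum_mul, hm]
    congr 1
    refine Finset.sum_congr rfl fun k _ => ?_
    rw [ih k k.2, innerL2_eval_mul_jacobiWeight ha hb, innerL2_eval_mul_jacobiWeight ha hb,
      eval_smul, smul_eq_mul, mul_assoc]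

theorem jueKernel_eq {a b : ℝ} (ha : -1 < a) (hb : -1 < b) (N : ℕ) (x y : ℝ) :
    jueKernel a b N x y = jacobiWeight (a / 2) (b / 2) x * jacobiWeight (a / 2) (b / 2) y *
      ∑ j ∈ Finset.range N, (monicOrthogonal (jacobiFunctional ha hb) j).eval x *
        (monicOrthogonal (jacobiFunctional ha hb) j).eval y /
        orthogonalNormSq (jacobiFunctional ha hb) j := by
  rw [jueKernel, Finset.mul_sum]
  refine Finset.sum_congr rfl fun j _ => ?_
  have h := orthogonalNormSq_pos (jacobiFunctional_pos ha hb) j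
  have e : innerL2 (jacobiOrthogonal a b j) (jacobiOrthogonal a b j) =
      orthogonalNormSq (jacobiFunctional ha hb) j := by
    rw [jacobiOrthogonal_eq ha hb, innerL2_eval_mul_jacobiWeight ha hb]; rfl
  rw [jacobiOrthonormal, jacobiOrthonormal, e, jacobiOrthogonal_eq ha hb, div_mul_div_comm,
    Real.mul_self_sqrt h.le]
  ring

end JacobiWeight

/-! ### The weighted energy identity and the amplitude at the origin. -/

section JacobiEnergy

open MeasureTheory Set Filter Topology

/-- The antiderivative of `-√(1 - x²)` vanishing at `1`, shifted by the constant `c`. -/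
noncomputable def semicirclePrimitive (c x : ℝ) : ℝ := (Real.arccos x - x * √(1 - x ^ 2)) / 2 - c

theorem one_sub_sq_pos {x : ℝ} (hx : x ∈ Ioo (-1 : ℝ) 1) : 0 < 1 - x ^ 2 := by
  nlinarith [hx.1, hx.2]

theorem hasDerivAt_sqrt_one_sub_sq {x : ℝ} (hx : x ∈ Ioo (-1 : ℝ) 1) :
    HasDerivAt (fun x : ℝ => √(1 - x ^ 2)) (-x / √(1 - x ^ 2)) x := by
  have h := ((hasDerivAt_pow 2 x).const_sub 1).sqrt (one_sub_sq_pos hx).ne'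
  refine h.congr_deriv ?_
  have := Real.sqrt_pos.2 (one_sub_sq_pos hx)
  field_simp
  norm_num

theorem hasDerivAt_semicirclePrimitive (c : ℝ) {x : ℝ} (hx : x ∈ Ioo (-1 : ℝ) 1) :
    HasDerivAt (semicirclePrimitive c) (-√(1 - x ^ 2)) x := by
  have h := (((Real.hasDerivAt_arccos hx.1.ne' hx.2.ne).sub
    ((hasDerivAt_id x).mul (hasDerivAt_sqrt_one_sub_sq hx))).div_const 2).sub_const c
  refine h.congr_deriv ?_
  have h0 := Real.sqrt_pos.2 (one_sub_sq_pos hx)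
  have h1 := Real.sq_sqrt (one_sub_sq_pos hx).le
  simp only [id]
  field_simp
  rw [h1]
  ring

theorem semicirclePrimitive_nonneg {x : ℝ} (hx : x ∈ Ico (0 : ℝ) 1) :
    0 ≤ semicirclePrimitive 0 x := by
  have hanti : AntitoneOn (semicirclePrimitive 0) (Icc 0 1) := by
    refine antitoneOn_of_deriv_nonpos (convex_Icc 0 1) ?_ ?_ ?_
    · exact Continuous.continuousOn (by
        unfold semicirclePrimitive; have := Real.continuous_arccos; fun_prop)
    · rw [interior_Icc]
      exact fun y hy => (hasDerivAt_semicirclePrimitive 0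
        ⟨by linarith [hy.1], hy.2⟩).differentiableAt.differentiableWithinAt
    · rw [interior_Icc]
      intro y hy
      rw [(hasDerivAt_semicirclePrimitive 0 ⟨by linarith [hy.1], hy.2⟩).deriv]
      exact neg_nonpos.2 (Real.sqrt_nonneg _)
  have := hanti ⟨hx.1, hx.2.le⟩ (right_mem_Icc.2 zero_le_one) hx.2.le
  simpa [semicirclePrimitive] using this

/-- The left side is the integral of the decreasing function `√(1 - t²)` over `[x, 1]`, at most the
length times the value at `x`. -/
theorem semicirclePrimitive_le {x : ℝ} (hx : x ∈ Ico (0 : ℝ) 1) :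
    semicirclePrimitive 0 x ≤ (1 - x) * √(1 - x ^ 2) := by
  have hd : ∀ y ∈ Ioo (0 : ℝ) 1, HasDerivAt
      (fun x => (1 - x) * √(1 - x ^ 2) - semicirclePrimitive 0 x)
      (-((1 - y) * y / √(1 - y ^ 2))) y := by
    intro y hy
    have hy' : y ∈ Ioo (-1 : ℝ) 1 := ⟨by linarith [hy.1], hy.2⟩
    have h := (((hasDerivAt_id y).const_sub 1).mul (hasDerivAt_sqrt_one_sub_sq hy')).sub
      (hasDerivAt_semicirclePrimitive 0 hy')
    refine h.congr_deriv ?_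
    have := Real.sqrt_pos.2 (one_sub_sq_pos hy')
    simp only [id]
    field_simp
    ring
  have hanti : AntitoneOn (fun x => (1 - x) * √(1 - x ^ 2) - semicirclePrimitive 0 x)
      (Icc 0 1) := by
    refine antitoneOn_of_deriv_nonpos (convex_Icc 0 1) ?_ ?_ ?_
    · exact Continuous.continuousOn (by
        unfold semicirclePrimitive; have := Real.continuous_arccos; fun_prop)
    · rw [interior_Icc]
      exact fun y hy => (hd y hy).differentiableAt.differentiableWithinAt
    · rw [interior_Icc]
      intro y hy
      rw [(hd y hy).deriv]
      exact neg_nonpos.2 (div_nonneg (mul_nonneg (by linarith [hy.2]) hy.1.le)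
        (Real.sqrt_nonneg _))
  have := hanti ⟨hx.1, hx.2.le⟩ (right_mem_Icc.2 zero_le_one) hx.2.le
  simp only [semicirclePrimitive] at this ⊢
  norm_num at this
  linarith

theorem abs_semicirclePrimitive_div_le_right {x : ℝ} (hx : x ∈ Ico (0 : ℝ) 1) :
    |semicirclePrimitive 0 x / √(1 - x ^ 2)| ≤ 1 - x := by
  have hs := Real.sqrt_pos.2 (one_sub_sq_pos ⟨by linarith [hx.1], hx.2⟩)
  rw [abs_of_nonneg (div_nonneg (semicirclePrimitive_nonneg hx) hs.le), div_le_iff₀ hs]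
  exact semicirclePrimitive_le hx

/-- Reflection `x ↦ -x`: since `arccos (-x) = π - arccos x`, the primitive vanishing at `-1` is
minus the reflected one vanishing at `1`. -/
theorem abs_semicirclePrimitive_div_le_left {x : ℝ} (hx : x ∈ Ioc (-1 : ℝ) 0) :
    |semicirclePrimitive (Real.pi / 2) x / √(1 - x ^ 2)| ≤ 1 + x := by
  have h := abs_semicirclePrimitive_div_le_right (x := -x)
    ⟨by linarith [hx.2], by linarith [hx.1]⟩
  have e : semicirclePrimitive (Real.pi / 2) x = -semicirclePrimitive 0 (-x) := by
    simp only [semicirclePrimitive, Real.arccos_neg, neg_sq]; ring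
  rw [e, neg_div, abs_neg]
  simpa using h

/-- The quadratic form multiplying the primitive of the semicircle in the Jacobi energy. -/
noncomputable def jacobiEnergyForm (a b n : ℝ) (p : ℝ[X]) (x : ℝ) : ℝ :=
  ((1 - x ^ 2) * (derivative p).eval x + ((b - a) - (a + b + 1) * x) / 2 * p.eval x) ^ 2 +
    ((1 - x ^ 2) * (n + (a + b + 1) / 2) ^ 2 +
      ((1 / 4 - a ^ 2) * (1 + x) + (1 / 4 - b ^ 2) * (1 - x)) / 2) * p.eval x ^ 2

/-- The part of the Jacobi energy that does not involve the primitive of the semicircle. -/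
noncomputable def jacobiEnergyRest (a b : ℝ) (p : ℝ[X]) (x : ℝ) : ℝ :=
  p.eval x * ((1 - x ^ 2) * (derivative p).eval x +
    ((b - a) - (a + b + 1) * x) / 2 * p.eval x) + x * p.eval x ^ 2

/-- The energy of a solution of the Jacobi equation, weighted by the primitive of the
semicircle. -/
noncomputable def jacobiEnergy (a b n c : ℝ) (p : ℝ[X]) (x : ℝ) : ℝ :=
  jacobiWeight a b x * (semicirclePrimitive c x / √(1 - x ^ 2) * jacobiEnergyForm a b n p x +
    (1 - x ^ 2) * jacobiEnergyRest a b p x)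

/-- The bounded part of the density of the derivative of the Jacobi energy. -/
noncomputable def jacobiEnergyDensity (a b c x : ℝ) : ℝ :=
  semicirclePrimitive c x / √(1 - x ^ 2) / (1 - x ^ 2) *
      (((1 / 4 - a ^ 2) * (1 + x) ^ 2 - (1 / 4 - b ^ 2) * (1 - x) ^ 2) / 2) -
    (2 * x ^ 2 - 1) - ((1 / 4 - a ^ 2) * (1 + x) + (1 / 4 - b ^ 2) * (1 - x))

/-- In the variable `θ`, with `u` the normal form of `p` and `S` the primitive of `sin² θ`, the
energy is `S (u'² + (ν² + q) u²) - sin² θ u u' + sin θ cos θ u²`. The two corrections remove `u'²`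
and `u u'` from the derivative, leaving `2 ν² sin² θ u²` and a multiple of `u²` independent of `n`.
-/
theorem hasDerivAt_jacobiEnergy {a b n : ℝ} (c : ℝ) {p : ℝ[X]}
    (hp : jacobiOperator a b p = -(C (n * (n + a + b + 1)) * p)) {x : ℝ}
    (hx : x ∈ Ioo (-1 : ℝ) 1) :
    HasDerivAt (jacobiEnergy a b n c p)
      (jacobiEnergyDensity a b c x * ((p * p).eval x * jacobiWeight a b x) -
        2 * (n + (a + b + 1) / 2) ^ 2 * (((1 - X ^ 2) * (p * p)).eval x * jacobiWeight a b x))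
      x := by
  have hσ := one_sub_sq_pos hx
  have hr := Real.sqrt_pos.2 hσ
  have hode := congrArg (eval x) hp
  simp only [jacobiOperator, eval_add, eval_mul, eval_sub, eval_one, eval_pow, eval_X, eval_C,
    eval_neg] at hode
  have dσ : HasDerivAt (fun x : ℝ => 1 - x ^ 2) (-(2 * x)) x := by
    refine ((hasDerivAt_pow 2 x).const_sub 1).congr_deriv ?_
    norm_num
  have dH : HasDerivAt (fun x => semicirclePrimitive c x / √(1 - x ^ 2))
      (-1 + x * (semicirclePrimitive c x / √(1 - x ^ 2)) / (1 - x ^ 2)) x := by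
    refine ((hasDerivAt_semicirclePrimitive c hx).div
      (hasDerivAt_sqrt_one_sub_sq hx) hr.ne').congr_deriv ?_
    rw [← Real.sq_sqrt hσ.le, Real.sqrt_sq hr.le]
    field_simp
    ring
  have dp : HasDerivAt (fun x => p.eval x) ((derivative p).eval x) x := p.hasDerivAt x
  have dp' : HasDerivAt (fun x => (derivative p).eval x) ((derivative (derivative p)).eval x) x :=
    (derivative p).hasDerivAt x
  have de : HasDerivAt (fun x : ℝ => ((b - a) - (a + b + 1) * x) / 2) (-(a + b + 1) / 2) x := by
    refine ((((hasDerivAt_id x).const_mul (a + b + 1)).const_sub (b - a)).div_const 2).congr_deriv ?_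
    ring
  have dQ : HasDerivAt (fun x : ℝ => ((1 / 4 - a ^ 2) * (1 + x) + (1 / 4 - b ^ 2) * (1 - x)) / 2)
      ((b ^ 2 - a ^ 2) / 2) x := by
    refine (((((hasDerivAt_id x).const_add 1).const_mul (1 / 4 - a ^ 2)).add
      (((hasDerivAt_id x).const_sub 1).const_mul (1 / 4 - b ^ 2))).div_const 2).congr_deriv ?_
    ring
  have dE := (dσ.mul dp').add (de.mul dp)
  have dS1 : HasDerivAt (jacobiEnergyForm a b n p) _ x :=
    (dE.pow 2).add (((dσ.mul_const ((n + (a + b + 1) / 2) ^ 2)).add dQ).mul (dp.pow 2))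
  have dS2 : HasDerivAt (jacobiEnergyRest a b p) _ x :=
    (dp.mul dE).add ((hasDerivAt_id x).mul (dp.pow 2))
  have dM : HasDerivAt (jacobiEnergy a b n c p) _ x :=
    (hasDerivAt_jacobiWeight a b hx).mul ((dH.mul dS1).add (dσ.mul dS2))
  refine dM.congr_deriv ?_
  simp only [id, Pi.add_apply, Pi.mul_apply, jacobiEnergyDensity, eval_mul, eval_sub,
    eval_one, eval_pow, eval_X]
  norm_num only [pow_one]
  unfold jacobiEnergyForm jacobiEnergyRest
  generalize semicirclePrimitive c x / √(1 - x ^ 2) = H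
  generalize jacobiWeight a b x = w
  generalize eval x (derivative (derivative p)) = p2 at *
  generalize eval x (derivative p) = p1 at *
  generalize eval x p = p0 at *
  have hσ' := hσ.ne'
  field_simp
  -- The equation is used with the multiplier that corresponds, up to sign and weight, to `2 S u' -
  -- sin² θ u`; the factor `16` clears denominators.
  linear_combination (16 * w * (1 - x ^ 2) * (2 * H * ((1 - x ^ 2) * p1 +
    ((b - a) - (a + b + 1) * x) / 2 * p0) + (1 - x ^ 2) * p0)) * hode


theorem abs_jacobiEnergyDensity_le {a b c x : ℝ} (hx : x ∈ Ioo (-1 : ℝ) 1)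
    (h : |semicirclePrimitive c x / √(1 - x ^ 2) / (1 - x ^ 2)| ≤ 1) :
    |jacobiEnergyDensity a b c x| ≤ 1 + 4 * |1 / 4 - a ^ 2| + 4 * |1 / 4 - b ^ 2| := by
  have h1 := hx.1
  have h2 := hx.2
  have e1 : |2 * x ^ 2 - 1| ≤ 1 := abs_le.2 ⟨by nlinarith, by nlinarith⟩
  have e2 : |(1 / 4 - a ^ 2) * (1 + x)| ≤ |1 / 4 - a ^ 2| * 2 := by
    rw [abs_mul]; gcongr; exact abs_le.2 ⟨by linarith, by linarith⟩
  have e3 : |(1 / 4 - b ^ 2) * (1 - x)| ≤ |1 / 4 - b ^ 2| * 2 := by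
    rw [abs_mul]; gcongr; exact abs_le.2 ⟨by linarith, by linarith⟩
  have e4 : |(1 / 4 - a ^ 2) * (1 + x) ^ 2| ≤ |1 / 4 - a ^ 2| * 4 := by
    rw [abs_mul]; gcongr; exact abs_le.2 ⟨by nlinarith, by nlinarith⟩
  have e5 : |(1 / 4 - b ^ 2) * (1 - x) ^ 2| ≤ |1 / 4 - b ^ 2| * 4 := by
    rw [abs_mul]; gcongr; exact abs_le.2 ⟨by nlinarith, by nlinarith⟩
  have e6 : |((1 / 4 - a ^ 2) * (1 + x) ^ 2 - (1 / 4 - b ^ 2) * (1 - x) ^ 2) / 2| ≤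
      2 * |1 / 4 - a ^ 2| + 2 * |1 / 4 - b ^ 2| := by
    rw [abs_div, abs_two]
    have := abs_sub ((1 / 4 - a ^ 2) * (1 + x) ^ 2) ((1 / 4 - b ^ 2) * (1 - x) ^ 2)
    linarith
  have e7 : |semicirclePrimitive c x / √(1 - x ^ 2) / (1 - x ^ 2) *
      (((1 / 4 - a ^ 2) * (1 + x) ^ 2 - (1 / 4 - b ^ 2) * (1 - x) ^ 2) / 2)| ≤
      1 * (2 * |1 / 4 - a ^ 2| + 2 * |1 / 4 - b ^ 2|) := by
    rw [abs_mul]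
    exact mul_le_mul h e6 (abs_nonneg _) zero_le_one
  have t1 := abs_sub (semicirclePrimitive c x / √(1 - x ^ 2) / (1 - x ^ 2) *
      (((1 / 4 - a ^ 2) * (1 + x) ^ 2 - (1 / 4 - b ^ 2) * (1 - x) ^ 2) / 2)) (2 * x ^ 2 - 1)
  have t2 := abs_sub (semicirclePrimitive c x / √(1 - x ^ 2) / (1 - x ^ 2) *
      (((1 / 4 - a ^ 2) * (1 + x) ^ 2 - (1 / 4 - b ^ 2) * (1 - x) ^ 2) / 2) - (2 * x ^ 2 - 1))
      ((1 / 4 - a ^ 2) * (1 + x) + (1 / 4 - b ^ 2) * (1 - x))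
  have t3 := abs_add_le ((1 / 4 - a ^ 2) * (1 + x)) ((1 / 4 - b ^ 2) * (1 - x))
  unfold jacobiEnergyDensity
  linarith

theorem measurable_jacobiEnergyDensity (a b c : ℝ) : Measurable (jacobiEnergyDensity a b c) := by
  unfold jacobiEnergyDensity semicirclePrimitive
  have := Real.continuous_arccos.measurable
  fun_prop

/-- The increment of the Jacobi energy over an interval. -/
theorem jacobiEnergy_increment {a b : ℝ} (ha : -1 < a) (hb : -1 < b) {n c u v A B : ℝ} {p : ℝ[X]}
    (hp : jacobiOperator a b p = -(C (n * (n + a + b + 1)) * p)) (hu : -1 ≤ u) (huv : u < v)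
    (hv : v ≤ 1)
    (hc : ∀ x ∈ Ioo u v, |semicirclePrimitive c x / √(1 - x ^ 2) / (1 - x ^ 2)| ≤ 1)
    (hA : Tendsto (jacobiEnergy a b n c p) (𝓝[>] u) (𝓝 A))
    (hB : Tendsto (jacobiEnergy a b n c p) (𝓝[<] v) (𝓝 B)) :
    |B - A + 2 * (n + (a + b + 1) / 2) ^ 2 *
      ∫ x in u..v, ((1 - X ^ 2) * (p * p)).eval x * jacobiWeight a b x| ≤
    (1 + 4 * |1 / 4 - a ^ 2| + 4 * |1 / 4 - b ^ 2|) *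
      ∫ x in u..v, (p * p).eval x * jacobiWeight a b x := by
  have hsub : uIcc u v ⊆ uIcc (-1 : ℝ) 1 := by
    rw [uIcc_of_le huv.le, uIcc_of_le (by norm_num)]; exact Icc_subset_Icc hu hv
  have i1 := (intervalIntegrable_eval_mul_jacobiWeight ha hb (p * p)).mono_set hsub
  have i2 := (intervalIntegrable_eval_mul_jacobiWeight ha hb ((1 - X ^ 2) * (p * p))).mono_set hsub
  have hIoo : ∀ x ∈ Ioo u v, x ∈ Ioo (-1 : ℝ) 1 := fun x hx =>
    ⟨hu.trans_lt hx.1, hx.2.trans_le hv⟩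
  have hw : ∀ x ∈ Ioo u v, 0 ≤ (p * p).eval x * jacobiWeight a b x := fun x hx => by
    rw [eval_mul]
    exact mul_nonneg (mul_self_nonneg _) (jacobiWeight_pos (hIoo x hx)).le
  have hbd : ∀ x ∈ Ioo u v,
      ‖jacobiEnergyDensity a b c x * ((p * p).eval x * jacobiWeight a b x)‖ ≤
      (1 + 4 * |1 / 4 - a ^ 2| + 4 * |1 / 4 - b ^ 2|) *
        ((p * p).eval x * jacobiWeight a b x) := fun x hx => by
    rw [norm_mul, Real.norm_of_nonneg (hw x hx), Real.norm_eq_abs]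
    exact mul_le_mul_of_nonneg_right (abs_jacobiEnergyDensity_le (hIoo x hx) (hc x hx)) (hw x hx)
  have hbd' : ∀ᵐ x, x ∈ Ioc u v →
      ‖jacobiEnergyDensity a b c x * ((p * p).eval x * jacobiWeight a b x)‖ ≤
      (1 + 4 * |1 / 4 - a ^ 2| + 4 * |1 / 4 - b ^ 2|) *
        ((p * p).eval x * jacobiWeight a b x) := by
    have : ∀ᵐ x : ℝ, x ≠ v := by simp [ae_iff]
    filter_upwards [this] with x hxv hx
    exact hbd x ⟨hx.1, lt_of_le_of_ne hx.2 hxv⟩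
  have i3 : IntervalIntegrable
      (fun x => jacobiEnergyDensity a b c x * ((p * p).eval x * jacobiWeight a b x)) volume u v := by
    refine (i1.const_mul (1 + 4 * |1 / 4 - a ^ 2| + 4 * |1 / 4 - b ^ 2|)).mono_fun' ?_ ?_
    · exact (measurable_jacobiEnergyDensity a b c).aestronglyMeasurable.mul
        (by rw [uIoc_of_le huv.le]; exact i1.1.aestronglyMeasurable)
    · rw [uIoc_of_le huv.le]
      exact (ae_restrict_iff' measurableSet_Ioc).2 hbd'
  -- One-sided limits are used because an endpoint may be `±1`, where the weight can be singular.
  have key := intervalIntegral.integral_eq_sub_of_hasDerivAt_of_tendsto huv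
    (fun x hx => hasDerivAt_jacobiEnergy c hp (hIoo x hx))
    (i3.sub (i2.const_mul (2 * (n + (a + b + 1) / 2) ^ 2))) hA hB
  rw [intervalIntegral.integral_sub i3 (i2.const_mul _), intervalIntegral.integral_const_mul] at key
  rw [show B - A = _ from key.symm, sub_add_cancel, ← intervalIntegral.integral_const_mul]
  rw [← Real.norm_eq_abs]
  exact intervalIntegral.norm_integral_le_of_norm_le huv.le hbd' (i1.const_mul _)

/-- The quotient of the primitive by `√(1 - x²)` and the factor `1 - x²` both contribute `1 - x`, so
the energy is `O((1 - x) ^ (a + 1))`. -/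
theorem tendsto_jacobiEnergy_right {a b : ℝ} (ha : -1 < a) (n : ℝ) (p : ℝ[X]) :
    Tendsto (jacobiEnergy a b n 0 p) (𝓝[<] 1) (𝓝 0) := by
  have hcont : Continuous fun x =>
      |jacobiEnergyForm a b n p x| + 2 * |jacobiEnergyRest a b p x| := by
    unfold jacobiEnergyForm jacobiEnergyRest
    have := p.continuous
    have := (derivative p).continuous
    fun_prop
  have hlim : Tendsto (fun x : ℝ => (1 - x) ^ (a + 1) * (1 + x) ^ b *
      (|jacobiEnergyForm a b n p x| + 2 * |jacobiEnergyRest a b p x|)) (𝓝[<] 1) (𝓝 0) := by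
    have : ContinuousAt (fun x : ℝ => (1 - x) ^ (a + 1) * (1 + x) ^ b *
      (|jacobiEnergyForm a b n p x| + 2 * |jacobiEnergyRest a b p x|)) 1 := by
      refine ContinuousAt.mul (ContinuousAt.mul ?_ ?_) hcont.continuousAt
      · exact ContinuousAt.rpow_const (by fun_prop) (Or.inr (by linarith))
      · exact ContinuousAt.rpow_const (by fun_prop) (Or.inl (by norm_num))
    have h := this.tendsto
    simp only [sub_self, Real.zero_rpow (show a + 1 ≠ 0 by linarith), zero_mul] at h
    exact h.mono_left nhdsWithin_le_nhds
  refine squeeze_zero_norm' ?_ hlim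
  filter_upwards [Ioo_mem_nhdsLT (zero_lt_one' ℝ)] with x hx
  have hx' : x ∈ Ioo (-1 : ℝ) 1 := ⟨by linarith [hx.1], hx.2⟩
  have h1 : 0 < 1 - x := by linarith [hx.2]
  have hH := abs_semicirclePrimitive_div_le_right ⟨hx.1.le, hx.2⟩
  have hw := jacobiWeight_pos (a := a) (b := b) hx'
  rw [Real.norm_eq_abs, jacobiEnergy, abs_mul, abs_of_pos hw]
  rw [show (1 - x) ^ (a + 1) * (1 + x) ^ b = jacobiWeight a b x * (1 - x) by
    rw [Real.rpow_add_one h1.ne', jacobiWeight]; ring, mul_assoc]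
  refine mul_le_mul_of_nonneg_left ((abs_add_le _ _).trans ?_) hw.le
  rw [abs_mul, abs_mul, abs_of_pos (one_sub_sq_pos hx')]
  have h3 : 1 - x ^ 2 ≤ (1 - x) * 2 := by nlinarith [hx.1, hx.2]
  nlinarith [mul_le_mul_of_nonneg_right hH (abs_nonneg (jacobiEnergyForm a b n p x)),
    mul_le_mul_of_nonneg_right h3 (abs_nonneg (jacobiEnergyRest a b p x))]

theorem tendsto_jacobiEnergy_left {a b : ℝ} (hb : -1 < b) (n : ℝ) (p : ℝ[X]) :
    Tendsto (jacobiEnergy a b n (Real.pi / 2) p) (𝓝[>] (-1)) (𝓝 0) := by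
  have hcont : Continuous fun x =>
      |jacobiEnergyForm a b n p x| + 2 * |jacobiEnergyRest a b p x| := by
    unfold jacobiEnergyForm jacobiEnergyRest
    have := p.continuous
    have := (derivative p).continuous
    fun_prop
  have hlim : Tendsto (fun x : ℝ => (1 - x) ^ a * (1 + x) ^ (b + 1) *
      (|jacobiEnergyForm a b n p x| + 2 * |jacobiEnergyRest a b p x|)) (𝓝[>] (-1)) (𝓝 0) := by
    have : ContinuousAt (fun x : ℝ => (1 - x) ^ a * (1 + x) ^ (b + 1) *
      (|jacobiEnergyForm a b n p x| + 2 * |jacobiEnergyRest a b p x|)) (-1) := by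
      refine ContinuousAt.mul (ContinuousAt.mul ?_ ?_) hcont.continuousAt
      · exact ContinuousAt.rpow_const (by fun_prop) (Or.inl (by norm_num))
      · exact ContinuousAt.rpow_const (by fun_prop) (Or.inr (by linarith))
    have h := this.tendsto
    simp only [add_neg_cancel, Real.zero_rpow (show b + 1 ≠ 0 by linarith), zero_mul,
      mul_zero] at h
    exact h.mono_left nhdsWithin_le_nhds
  refine squeeze_zero_norm' ?_ hlim
  filter_upwards [Ioo_mem_nhdsGT (show (-1 : ℝ) < 0 by norm_num)] with x hx
  have hx' : x ∈ Ioo (-1 : ℝ) 1 := ⟨hx.1, by linarith [hx.2]⟩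
  have h1 : 0 < 1 + x := by linarith [hx.1]
  have hH := abs_semicirclePrimitive_div_le_left ⟨hx.1, hx.2.le⟩
  have hw := jacobiWeight_pos (a := a) (b := b) hx'
  rw [Real.norm_eq_abs, jacobiEnergy, abs_mul, abs_of_pos hw]
  rw [show (1 - x) ^ a * (1 + x) ^ (b + 1) = jacobiWeight a b x * (1 + x) by
    rw [Real.rpow_add_one h1.ne', jacobiWeight]; ring, mul_assoc]
  refine mul_le_mul_of_nonneg_left ((abs_add_le _ _).trans ?_) hw.le
  rw [abs_mul, abs_mul, abs_of_pos (one_sub_sq_pos hx')]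
  have h3 : 1 - x ^ 2 ≤ (1 + x) * 2 := by nlinarith [hx.1, hx.2]
  nlinarith [mul_le_mul_of_nonneg_right hH (abs_nonneg (jacobiEnergyForm a b n p x)),
    mul_le_mul_of_nonneg_right h3 (abs_nonneg (jacobiEnergyRest a b p x))]

/-- The energy at the origin of a polynomial solution of the Jacobi equation. -/
theorem jacobiEnergyForm_zero {a b : ℝ} (ha : -1 < a) (hb : -1 < b) {n : ℝ} {p : ℝ[X]}
    (hp : jacobiOperator a b p = -(C (n * (n + a + b + 1)) * p)) :
    |Real.pi / 2 * jacobiEnergyForm a b n p 0 - 2 * (n + (a + b + 1) / 2) ^ 2 *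
      jacobiFunctional ha hb ((1 - X ^ 2) * (p * p))| ≤
    (1 + 4 * |1 / 4 - a ^ 2| + 4 * |1 / 4 - b ^ 2|) * jacobiFunctional ha hb (p * p) := by
  have h0 : (0 : ℝ) ∈ Ioo (-1 : ℝ) 1 := by norm_num
  have hc : ∀ c, Tendsto (jacobiEnergy a b n c p) (𝓝 0) (𝓝 (jacobiEnergy a b n c p 0)) :=
    fun c => (hasDerivAt_jacobiEnergy c hp h0).continuousAt.tendsto
  have hr := jacobiEnergy_increment ha hb (u := 0) (v := 1) (c := 0) hp (by norm_num) (by norm_num)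
    le_rfl (fun x hx => by
      have hx' : x ∈ Ioo (-1 : ℝ) 1 := ⟨by linarith [hx.1], hx.2⟩
      have h := abs_semicirclePrimitive_div_le_right ⟨hx.1.le, hx.2⟩
      rw [abs_div, abs_of_pos (one_sub_sq_pos hx'), div_le_one (one_sub_sq_pos hx')]
      nlinarith [hx.1, hx.2])
    ((hc 0).mono_left nhdsWithin_le_nhds) (tendsto_jacobiEnergy_right ha n p)
  have hl := jacobiEnergy_increment ha hb (u := -1) (v := 0) (c := Real.pi / 2) hp le_rfl
    (by norm_num) (by norm_num) (fun x hx => by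
      have hx' : x ∈ Ioo (-1 : ℝ) 1 := ⟨hx.1, by linarith [hx.2]⟩
      have h := abs_semicirclePrimitive_div_le_left ⟨hx.1, hx.2.le⟩
      rw [abs_div, abs_of_pos (one_sub_sq_pos hx'), div_le_one (one_sub_sq_pos hx')]
      nlinarith [hx.1, hx.2])
    (tendsto_jacobiEnergy_left hb n p) ((hc (Real.pi / 2)).mono_left nhdsWithin_le_nhds)
  have hadd : ∀ q : ℝ[X], jacobiFunctional ha hb q =
      (∫ x in (-1 : ℝ)..0, q.eval x * jacobiWeight a b x) +
        ∫ x in (0 : ℝ)..1, q.eval x * jacobiWeight a b x := by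
    intro q
    have := intervalIntegrable_eval_mul_jacobiWeight ha hb q
    rw [jacobiFunctional_apply, intervalIntegral.integral_add_adjacent_intervals]
    · refine this.mono_set ?_
      rw [uIcc_of_le (by norm_num), uIcc_of_le (by norm_num)]
      exact Icc_subset_Icc le_rfl (by norm_num)
    · refine this.mono_set ?_
      rw [uIcc_of_le (by norm_num), uIcc_of_le (by norm_num)]
      exact Icc_subset_Icc (by norm_num) le_rfl
  -- The energies for `c = 0` and `c = π / 2` differ at the origin by exactly `π / 2` times the
  -- form; the remaining terms cancel when the two halves are added.
  have e : ∀ c, jacobiEnergy a b n c p 0 =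
      (Real.pi / 4 - c) * jacobiEnergyForm a b n p 0 + jacobiEnergyRest a b p 0 := by
    intro c
    simp only [jacobiEnergy, jacobiWeight, semicirclePrimitive]
    norm_num [Real.arccos_zero]
    left; ring
  rw [e] at hr hl
  rw [hadd, hadd, abs_le]
  rw [abs_le] at hr hl
  constructor <;> nlinarith [hr.1, hr.2, hl.1, hl.2]

end JacobiEnergy

/-! ### Asymptotics of the recurrence coefficients and of the values at the origin. -/

section JacobiAsymptotics

open Filter Asymptotics Topology

theorem isBigO_inv_nat_one : (fun n : ℕ => ((n : ℝ))⁻¹) =O[atTop] fun _ => (1 : ℝ) :=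
  (tendsto_inv_atTop_nhds_zero_nat (𝕜 := ℝ)).isBigO_one ℝ

theorem isBigO_one_of_sub_const {f : ℕ → ℝ} {c : ℝ}
    (hf : (fun n => f n - c) =O[atTop] fun n : ℕ => (n : ℝ)⁻¹) :
    f =O[atTop] fun _ => (1 : ℝ) := by
  have := (hf.trans isBigO_inv_nat_one).add (isBigO_const_one ℝ c atTop)
  simpa using this

theorem isBigO_mul_sub_const {f g : ℕ → ℝ} {c d : ℝ}
    (hf : (fun n => f n - c) =O[atTop] fun n : ℕ => (n : ℝ)⁻¹)
    (hg : (fun n => g n - d) =O[atTop] fun n : ℕ => (n : ℝ)⁻¹) :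
    (fun n => f n * g n - c * d) =O[atTop] fun n : ℕ => (n : ℝ)⁻¹ := by
  have h1 := hf.mul (isBigO_one_of_sub_const hg)
  have h2 := hg.const_mul_left c
  simp only [mul_one] at h1
  refine (h1.add h2).congr_left fun n => ?_
  ring

theorem isBigO_inv_linear (u c : ℝ) (hu : 1 ≤ u) :
    (fun n : ℕ => (u * n + c)⁻¹) =O[atTop] fun n : ℕ => (n : ℝ)⁻¹ := by
  refine IsBigO.of_bound 2 ?_
  filter_upwards [eventually_gt_atTop 0, tendsto_natCast_atTop_atTop.eventually_ge_atTop (2 * |c|)]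
    with n hn hc
  have hn' : (0 : ℝ) < n := by exact_mod_cast hn
  have h := neg_abs_le c
  have : (n : ℝ) / 2 ≤ u * n + c := by nlinarith
  rw [norm_inv, norm_inv, Real.norm_of_nonneg (by linarith), Real.norm_of_nonneg hn'.le,
    inv_le_comm₀ (by linarith) (by positivity)]
  rw [mul_inv, inv_inv]
  linarith

theorem isBigO_linear_div_sub_half (c d : ℝ) :
    (fun n : ℕ => (n + c) / (2 * n + d) - 1 / 2) =O[atTop] fun n : ℕ => (n : ℝ)⁻¹ := by
  refine ((isBigO_inv_linear 2 d (by norm_num)).const_mul_left (c - d / 2)).congr' ?_ .rfl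
  filter_upwards [tendsto_natCast_atTop_atTop.eventually_gt_atTop |d|] with n hn
  have h := neg_abs_le d
  have hn' : (0 : ℝ) ≤ n := n.cast_nonneg
  have : 2 * (n : ℝ) + d ≠ 0 := by linarith
  field_simp
  ring

variable {a b : ℝ} (ha : -1 < a) (hb : -1 < b)

local notation "𝖫" => jacobiFunctional ha hb
local notation "𝖯" => monicOrthogonal (jacobiFunctional ha hb)
local notation "𝗁" => orthogonalNormSq (jacobiFunctional ha hb)

theorem jacobi_norm_pos (n : ℕ) : 0 < 𝗁 n := orthogonalNormSq_pos (jacobiFunctional_pos ha hb) n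

theorem jacobi_ode (n : ℕ) :
    jacobiOperator a b (𝖯 n) = -(C (n * (n + a + b + 1)) * 𝖯 n) :=
  jacobiOperator_monicOrthogonal (jacobiFunctional_pos ha hb) (jacobiFunctional_pearson ha hb) n

theorem jacobi_diag_isBigO :
    (fun n : ℕ => (𝖯 (n + 1)).coeff n - (𝖯 (n + 2)).coeff (n + 1)) =O[atTop]
      fun n : ℕ => (n : ℝ)⁻¹ := by
  have h := ((isBigO_inv_linear 2 (a + b + 2) (by norm_num)).mul
    ((isBigO_inv_linear 2 (a + b + 4) (by norm_num)).trans isBigO_inv_nat_one)).const_mul_left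
      ((b - a) * (a + b))
  simp only [mul_one] at h
  refine h.congr_left fun n => ?_
  rw [jacobi_recurrence_diag (jacobiFunctional_pos ha hb) (jacobiFunctional_pearson ha hb) ha hb,
    ← mul_inv, div_eq_mul_inv, show 2 * (n : ℝ) + a + b + 2 = 2 * n + (a + b + 2) by ring,
    show 2 * (n : ℝ) + a + b + 4 = 2 * n + (a + b + 4) by ring]

theorem jacobi_ratio_isBigO :
    (fun n : ℕ => 𝗁 (n + 2) / 𝗁 (n + 1) - 1 / 4) =O[atTop] fun n : ℕ => (n : ℝ)⁻¹ := by
  have h := (isBigO_mul_sub_const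
    (isBigO_mul_sub_const (isBigO_linear_div_sub_half 2 (a + b + 4))
      (isBigO_linear_div_sub_half (2 + a) (a + b + 4)))
    (isBigO_mul_sub_const (isBigO_linear_div_sub_half (2 + b) (a + b + 5))
      (isBigO_linear_div_sub_half (2 + a + b) (a + b + 3)))).const_mul_left 4
  refine h.congr_left fun n => ?_
  rw [orthogonalNormSq_ratio (jacobiFunctional_pos ha hb) (jacobiFunctional_pearson ha hb) ha hb]
  rw [show 2 * (n : ℝ) + a + b + 3 = 2 * n + (a + b + 3) by ring,
    show 2 * (n : ℝ) + a + b + 4 = 2 * n + (a + b + 4) by ring,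
    show 2 * (n : ℝ) + a + b + 5 = 2 * n + (a + b + 5) by ring]
  generalize 2 * (n : ℝ) + (a + b + 3) = u
  generalize 2 * (n : ℝ) + (a + b + 4) = v
  generalize 2 * (n : ℝ) + (a + b + 5) = w
  ring

/-- At `0` the left side of the recurrence vanishes, so adding `n + 1` times it to the structure
relation eliminates `P_(n+2)`. The companion lemma eliminates `P_n` instead. -/
theorem jacobi_deriv_zero_up (n : ℕ) :
    (derivative (𝖯 (n + 1))).eval 0 =
      (((a + b + 2) * ((𝖯 (n + 1)).coeff n - (𝖯 (n + 2)).coeff (n + 1)) + a - b) / 2 +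
        (n + 1) * ((𝖯 (n + 1)).coeff n - (𝖯 (n + 2)).coeff (n + 1))) * (𝖯 (n + 1)).eval 0 +
      (2 * n + a + b + 3) * (𝗁 (n + 1) / 𝗁 n) * (𝖯 n).eval 0 := by
  have h1 := congrArg (eval 0) (jacobi_structure (jacobiFunctional_pos ha hb)
    (jacobiFunctional_pearson ha hb) n)
  have h2 := congrArg (eval 0) (monicOrthogonal_recurrence (jacobiFunctional_pos ha hb) n)
  simp only [eval_add, eval_mul, eval_sub, eval_one, eval_pow, eval_X, eval_C, eval_neg] at h1 h2
  linear_combination h1 + (n + 1 : ℝ) * h2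

theorem jacobi_deriv_zero_down (n : ℕ) :
    (derivative (𝖯 (n + 1))).eval 0 =
      -((2 * n + a + b + 3) * (𝖯 (n + 2)).eval 0) +
      (((a + b + 2) * ((𝖯 (n + 1)).coeff n - (𝖯 (n + 2)).coeff (n + 1)) + a - b) / 2 -
        (n + a + b + 2) * ((𝖯 (n + 1)).coeff n - (𝖯 (n + 2)).coeff (n + 1))) *
          (𝖯 (n + 1)).eval 0 := by
  have h1 := congrArg (eval 0) (jacobi_structure (jacobiFunctional_pos ha hb)
    (jacobiFunctional_pearson ha hb) n)
  have h2 := congrArg (eval 0) (monicOrthogonal_recurrence (jacobiFunctional_pos ha hb) n)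
  simp only [eval_add, eval_mul, eval_sub, eval_one, eval_pow, eval_X, eval_C, eval_neg] at h1 h2
  linear_combination h1 - (n + a + b + 2 : ℝ) * h2

/-- The second moment of the orthonormal Jacobi functions tends to `1 / 2`. -/
theorem jacobi_second_moment_isBigO :
    (fun n : ℕ => 𝖫 ((1 - X ^ 2) * (𝖯 (n + 2) * 𝖯 (n + 2))) / 𝗁 (n + 2) - 1 / 2) =O[atTop]
      fun n : ℕ => (n : ℝ)⁻¹ := by
  have hshift : (fun n : ℕ => ((n + 1 : ℕ) : ℝ)⁻¹) =O[atTop] fun n : ℕ => (n : ℝ)⁻¹ := by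
    simpa using isBigO_inv_linear 1 1 le_rfl
  have hg := jacobi_ratio_isBigO ha hb
  have hg1 := (hg.comp_tendsto (tendsto_add_atTop_nat 1)).trans hshift
  have hd := ((jacobi_diag_isBigO ha hb).comp_tendsto (tendsto_add_atTop_nat 1)).trans hshift
  have hd2 := hd.mul (hd.trans isBigO_inv_nat_one)
  simp only [mul_one] at hd2
  refine ((hg1.add hd2).add hg).neg_left.congr_left fun n => ?_
  simp only [Function.comp]
  rw [orthogonal_second_moment (jacobiFunctional_pos ha hb) (n + 1),
    mul_div_cancel_left₀ _ (jacobi_norm_pos ha hb _).ne']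
  ring

/-- The value at the origin of the orthonormal Jacobi polynomial. -/
noncomputable def jacobiValueZero (n : ℕ) : ℝ := (𝖯 n).eval 0 / √(𝗁 n)

/-- The derivative at the origin of the orthonormal Jacobi polynomial. -/
noncomputable def jacobiDerivZero (n : ℕ) : ℝ := (derivative (𝖯 n)).eval 0 / √(𝗁 n)

/-- This is `jacobiEnergyForm_zero` divided by `h ν²`: its error becomes `O(1 / ν²)`, and the second
moment `1 / 2` yields `2 / π`. -/
theorem jacobi_energy_zero_isBigO :
    (fun n : ℕ => ((jacobiDerivZero ha hb (n + 2) + (b - a) / 2 * jacobiValueZero ha hb (n + 2)) /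
        (n + 2 + (a + b + 1) / 2)) ^ 2 +
      (1 + (1 / 2 - a ^ 2 - b ^ 2) / 2 / (n + 2 + (a + b + 1) / 2) ^ 2) *
        jacobiValueZero ha hb (n + 2) ^ 2 - 2 / Real.pi) =O[atTop] fun n : ℕ => (n : ℝ)⁻¹ := by
  have hν := isBigO_inv_linear 1 (2 + (a + b + 1) / 2) le_rfl
  have hν2 := hν.mul (hν.trans isBigO_inv_nat_one)
  simp only [mul_one] at hν2
  set K := 1 + 4 * |1 / 4 - a ^ 2| + 4 * |1 / 4 - b ^ 2| with hK
  have hE : (fun n : ℕ => Real.pi / 2 * (jacobiEnergyForm a b (n + 2) (𝖯 (n + 2)) 0 / 𝗁 (n + 2)) *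
      ((1 * n + (2 + (a + b + 1) / 2))⁻¹ * (1 * n + (2 + (a + b + 1) / 2))⁻¹) -
      2 * (𝖫 ((1 - X ^ 2) * (𝖯 (n + 2) * 𝖯 (n + 2))) / 𝗁 (n + 2))) =O[atTop]
      fun n : ℕ => (n : ℝ)⁻¹ := by
    refine (IsBigO.of_bound K ?_).trans hν2
    filter_upwards with n
    have hode := jacobi_ode ha hb (n + 2)
    push_cast at hode
    have h := jacobiEnergyForm_zero ha hb hode
    have hh := jacobi_norm_pos ha hb (n + 2)
    rw [show 𝖫 (𝖯 (n + 2) * 𝖯 (n + 2)) = 𝗁 (n + 2) from rfl, ← hK] at h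
    have hn : (0 : ℝ) ≤ n := n.cast_nonneg
    have hpos : 0 < (n : ℝ) + 2 + (a + b + 1) / 2 := by linarith
    rw [one_mul, ← add_assoc, Real.norm_eq_abs, norm_mul, norm_inv, Real.norm_of_nonneg hpos.le]
    generalize (n : ℝ) + 2 + (a + b + 1) / 2 = ν at *
    have e : Real.pi / 2 * (jacobiEnergyForm a b (n + 2) (𝖯 (n + 2)) 0 / 𝗁 (n + 2)) *
        (ν⁻¹ * ν⁻¹) - 2 * (𝖫 ((1 - X ^ 2) * (𝖯 (n + 2) * 𝖯 (n + 2))) / 𝗁 (n + 2)) =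
        (Real.pi / 2 * jacobiEnergyForm a b (n + 2) (𝖯 (n + 2)) 0 - 2 * ν ^ 2 *
        𝖫 ((1 - X ^ 2) * (𝖯 (n + 2) * 𝖯 (n + 2)))) * ((𝗁 (n + 2))⁻¹ * (ν⁻¹ * ν⁻¹)) := by
      field_simp
    rw [e, abs_mul, abs_of_pos (by positivity : 0 < (𝗁 (n + 2))⁻¹ * (ν⁻¹ * ν⁻¹))]
    refine (mul_le_mul_of_nonneg_right h (by positivity)).trans (le_of_eq ?_)
    field_simp
  have hfin := (hE.add ((jacobi_second_moment_isBigO ha hb).const_mul_left 2)).const_mul_left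
    (2 / Real.pi)
  refine hfin.congr_left fun n => ?_
  have hh := jacobi_norm_pos ha hb (n + 2)
  have hs := Real.sqrt_pos.2 hh
  have hn : (0 : ℝ) ≤ n := n.cast_nonneg
  have hpos : 0 < (n : ℝ) + 2 + (a + b + 1) / 2 := by linarith
  rw [one_mul, ← add_assoc]
  simp only [jacobiEnergyForm, jacobiValueZero, jacobiDerivZero]
  generalize (n : ℝ) + 2 + (a + b + 1) / 2 = ν at *
  have h2 : 𝗁 (n + 2) = √(𝗁 (n + 2)) ^ 2 := (Real.sq_sqrt hh.le).symm
  generalize √(𝗁 (n + 2)) = s at *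
  have hpi := Real.pi_pos
  rw [h2]
  field_simp
  ring

theorem exists_abs_jacobiValueZero_le : ∃ M, ∀ n, |jacobiValueZero ha hb n| ≤ M := by
  have h0 := isBigO_one_of_sub_const (jacobi_energy_zero_isBigO ha hb)
  obtain ⟨c, hc0, hc⟩ := h0.exists_pos
  have hev : ∀ᶠ n : ℕ in atTop, |jacobiValueZero ha hb (n + 2)| ≤ 1 + 2 * c := by
    have hν : Tendsto (fun n : ℕ => (n : ℝ) + 2 + (a + b + 1) / 2) atTop atTop :=
      tendsto_atTop_add_const_right _ _ (tendsto_atTop_add_const_right _ _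
        tendsto_natCast_atTop_atTop)
    -- Beyond this threshold `|Q| / ν² ≤ 1 / 2`, so the energy controls half the squared value.
    filter_upwards [hc.bound, hν.eventually_ge_atTop (1 + |(1 / 2 - a ^ 2 - b ^ 2) / 2| * 2)]
      with n hn hν
    generalize (n : ℝ) + 2 + (a + b + 1) / 2 = ν at *
    generalize (1 / 2 - a ^ 2 - b ^ 2) / 2 = Q at *
    set A := jacobiValueZero ha hb (n + 2)
    rw [norm_one, mul_one] at hn
    have hle := (le_abs_self _).trans hn
    have hν1 : 1 ≤ ν := by linarith [abs_nonneg Q]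
    have hQ : |Q / ν ^ 2| ≤ 1 / 2 := by
      rw [abs_div, abs_of_pos (by positivity : 0 < ν ^ 2), div_le_iff₀ (by positivity)]
      nlinarith [abs_nonneg Q]
    have hQ' := (abs_le.1 hQ).1
    have hA : A ^ 2 ≤ 2 * c := by
      nlinarith [sq_nonneg A, sq_nonneg ((jacobiDerivZero ha hb (n + 2) + (b - a) / 2 * A) / ν)]
    refine abs_le_of_sq_le_sq (by nlinarith) (by linarith)
  have hO : (fun n => jacobiValueZero ha hb n) =O[atTop] fun _ => (1 : ℝ) := by
    refine IsBigO.of_bound (1 + 2 * c) ?_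
    obtain ⟨m, hm⟩ := eventually_atTop.1 hev
    filter_upwards [eventually_ge_atTop (m + 2)] with n hn
    obtain ⟨k, rfl⟩ : ∃ k, n = k + 2 := ⟨n - 2, by omega⟩
    simpa using hm k (by omega)
  exact (isBigO_one_nat_atTop_iff).1 hO

/-- The derivative at the origin in terms of the two previous values. -/
theorem jacobiDerivZero_up (n : ℕ) :
    jacobiDerivZero ha hb (n + 2) =
      (((a + b + 2) * ((𝖯 (n + 2)).coeff (n + 1) - (𝖯 (n + 3)).coeff (n + 2)) + a - b) / 2 +
        (n + 2) * ((𝖯 (n + 2)).coeff (n + 1) - (𝖯 (n + 3)).coeff (n + 2))) *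
          jacobiValueZero ha hb (n + 2) +
      (2 * n + a + b + 5) * √(𝗁 (n + 2) / 𝗁 (n + 1)) * jacobiValueZero ha hb (n + 1) := by
  have h := jacobi_deriv_zero_up ha hb (n + 1)
  simp only [jacobiDerivZero, jacobiValueZero]
  rw [h, Real.sqrt_div (jacobi_norm_pos ha hb _).le]
  have h1 := jacobi_norm_pos ha hb (n + 1)
  have h2 := jacobi_norm_pos ha hb (n + 2)
  have s1 := Real.sqrt_pos.2 h1
  have s2 := Real.sqrt_pos.2 h2
  have e1 := Real.sq_sqrt h1.le
  have e2 := Real.sq_sqrt h2.le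
  rw [show n + 1 + 1 = n + 2 from rfl, show n + 1 + 2 = n + 3 from rfl, ← e1, ← e2,
    Real.sqrt_sq s1.le, Real.sqrt_sq s2.le]
  push_cast
  field_simp
  ring

theorem jacobiDerivZero_down (n : ℕ) :
    jacobiDerivZero ha hb (n + 1) =
      -((2 * n + a + b + 3) * √(𝗁 (n + 2) / 𝗁 (n + 1)) * jacobiValueZero ha hb (n + 2)) +
      (((a + b + 2) * ((𝖯 (n + 1)).coeff n - (𝖯 (n + 2)).coeff (n + 1)) + a - b) / 2 -
        (n + a + b + 2) * ((𝖯 (n + 1)).coeff n - (𝖯 (n + 2)).coeff (n + 1))) *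
          jacobiValueZero ha hb (n + 1) := by
  have h := jacobi_deriv_zero_down ha hb n
  simp only [jacobiDerivZero, jacobiValueZero]
  rw [h, Real.sqrt_div (jacobi_norm_pos ha hb _).le]
  have s1 := Real.sqrt_pos.2 (jacobi_norm_pos ha hb (n + 1))
  have s2 := Real.sqrt_pos.2 (jacobi_norm_pos ha hb (n + 2))
  field_simp

theorem isBigO_sqrt_jacobi_ratio :
    (fun n : ℕ => √(𝗁 (n + 2) / 𝗁 (n + 1))) =O[atTop] fun _ => (1 : ℝ) := by
  have h := (isBigO_one_of_sub_const (jacobi_ratio_isBigO ha hb)).add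
    (isBigO_const_one ℝ (1 : ℝ) atTop)
  refine (IsBigO.of_bound 1 ?_).trans h
  filter_upwards with n
  have h0 := (div_pos (jacobi_norm_pos ha hb (n + 2)) (jacobi_norm_pos ha hb (n + 1))).le
  generalize 𝗁 (n + 2) / 𝗁 (n + 1) = γ at *
  rw [Real.norm_of_nonneg (Real.sqrt_nonneg _), Real.norm_of_nonneg (by linarith), one_mul,
    Real.sqrt_le_left (by linarith)]
  nlinarith

theorem isBigO_jacobiValueZero (k : ℕ) :
    (fun n : ℕ => jacobiValueZero ha hb (n + k)) =O[atTop] fun _ => (1 : ℝ) := by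
  obtain ⟨M, hM⟩ := exists_abs_jacobiValueZero_le ha hb
  exact IsBigO.of_bound M (Eventually.of_forall fun n => by simpa using hM (n + k))

theorem natCast_mul_jacobi_diag_isBigO (c : ℝ) :
    (fun n : ℕ => (n + c) * ((𝖯 (n + 1)).coeff n - (𝖯 (n + 2)).coeff (n + 1))) =O[atTop]
      fun _ => (1 : ℝ) := by
  have h1 : (fun n : ℕ => (n : ℝ) + c) =O[atTop] fun n : ℕ => (n : ℝ) :=
    (isBigO_refl _ _).add (isLittleO_const_left.2 (Or.inr
      (tendsto_norm_atTop_atTop.comp tendsto_natCast_atTop_atTop))).isBigO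
  refine (h1.mul (jacobi_diag_isBigO ha hb)).trans (IsBigO.of_bound 1 ?_)
  filter_upwards [eventually_gt_atTop 0] with n hn
  have : (n : ℝ) ≠ 0 := by exact_mod_cast hn.ne'
  rw [mul_inv_cancel₀ this, one_mul]

/-- The diagonal recurrence coefficient is `O(1 / n)`, so it stays bounded after multiplication by
`n`; only the neighbouring value carries a factor of order `n`. -/
theorem jacobiDerivZero_up_isBigO : ∃ α : ℕ → ℝ, α =O[atTop] (fun _ => (1 : ℝ)) ∧
    ∀ n : ℕ, jacobiDerivZero ha hb (n + 2) = α n * jacobiValueZero ha hb (n + 2) +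
      (2 * n + a + b + 5) * √(𝗁 (n + 2) / 𝗁 (n + 1)) * jacobiValueZero ha hb (n + 1) := by
  refine ⟨_, ?_, jacobiDerivZero_up ha hb⟩
  have h := (((natCast_mul_jacobi_diag_isBigO ha hb (1 + (a + b + 2) / 2)).comp_tendsto
    (tendsto_add_atTop_nat 1))).add (isBigO_const_one ℝ ((a - b) / 2) atTop)
  refine h.congr_left fun n => ?_
  simp only [Function.comp]
  push_cast
  ring

theorem jacobiDerivZero_down_isBigO : ∃ α : ℕ → ℝ, α =O[atTop] (fun _ => (1 : ℝ)) ∧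
    ∀ n : ℕ, jacobiDerivZero ha hb (n + 1) = α n * jacobiValueZero ha hb (n + 1) -
      (2 * n + a + b + 3) * √(𝗁 (n + 2) / 𝗁 (n + 1)) * jacobiValueZero ha hb (n + 2) := by
  refine ⟨fun n => (((a + b + 2) * ((𝖯 (n + 1)).coeff n - (𝖯 (n + 2)).coeff (n + 1)) + a - b) / 2 -
        (n + a + b + 2) * ((𝖯 (n + 1)).coeff n - (𝖯 (n + 2)).coeff (n + 1))), ?_, fun n => ?_⟩
  · have h := (natCast_mul_jacobi_diag_isBigO ha hb ((a + b + 2) / 2)).neg_left.add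
      (isBigO_const_one ℝ ((a - b) / 2) atTop)
    refine h.congr_left fun n => ?_
    ring
  · rw [jacobiDerivZero_down]
    ring

theorem jacobi_scaled_deriv_up :
    (fun n : ℕ => jacobiDerivZero ha hb (n + 2) / (n + 2) -
      2 * (√(𝗁 (n + 2) / 𝗁 (n + 1)) * jacobiValueZero ha hb (n + 1))) =O[atTop]
      fun n : ℕ => (n : ℝ)⁻¹ := by
  obtain ⟨α, hα, h⟩ := jacobiDerivZero_up_isBigO ha hb
  have h1 := (((hα.mul (isBigO_jacobiValueZero ha hb 2)).add (((isBigO_sqrt_jacobi_ratio ha hb).mul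
    (isBigO_jacobiValueZero ha hb 1)).const_mul_left (a + b + 1))).mul
      (isBigO_inv_linear 1 2 le_rfl))
  simp only [one_mul, mul_one] at h1
  refine h1.congr_left fun n => ?_
  have hn : (n : ℝ) + 2 ≠ 0 := by positivity
  rw [h]
  field_simp
  ring

theorem jacobi_scaled_deriv_down :
    (fun n : ℕ => jacobiDerivZero ha hb (n + 1) / (n + 2) +
      2 * (√(𝗁 (n + 2) / 𝗁 (n + 1)) * jacobiValueZero ha hb (n + 2))) =O[atTop]
      fun n : ℕ => (n : ℝ)⁻¹ := by
  obtain ⟨α, hα, h⟩ := jacobiDerivZero_down_isBigO ha hb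
  have h1 := (((hα.mul (isBigO_jacobiValueZero ha hb 1)).add (((isBigO_sqrt_jacobi_ratio ha hb).mul
    (isBigO_jacobiValueZero ha hb 2)).const_mul_left (-(a + b - 1)))).mul
      (isBigO_inv_linear 1 2 le_rfl))
  simp only [one_mul, mul_one] at h1
  refine h1.congr_left fun n => ?_
  have hn : (n : ℝ) + 2 ≠ 0 := by positivity
  rw [h]
  field_simp
  ring

/-- Two consecutive orthonormal Jacobi polynomials at the origin. -/
theorem jacobi_sum_sq_isBigO :
    (fun n : ℕ => jacobiValueZero ha hb (n + 1) ^ 2 + jacobiValueZero ha hb (n + 2) ^ 2 -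
      2 / Real.pi) =O[atTop] fun n : ℕ => (n : ℝ)⁻¹ := by
  obtain ⟨α, hα, h⟩ := jacobiDerivZero_up_isBigO ha hb
  have hA := isBigO_jacobiValueZero ha hb 2
  have hA' := isBigO_jacobiValueZero ha hb 1
  have hν := isBigO_inv_linear 1 (2 + (a + b + 1) / 2) le_rfl
  have hg := isBigO_sqrt_jacobi_ratio ha hb
  have hu := ((hα.add (isBigO_const_one ℝ ((b - a) / 2) atTop)).mul hA).mul hν
  simp only [one_mul] at hu
  have hu2 := hu.mul (hu.trans isBigO_inv_nat_one)
  have hcross := ((hg.mul hA').mul hu).const_mul_left 4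
  have hγ := ((jacobi_ratio_isBigO ha hb).mul (hA'.mul hA')).const_mul_left 4
  have hQ := ((hν.mul (hν.trans isBigO_inv_nat_one)).mul (hA.mul hA)).const_mul_left
    ((1 / 2 - a ^ 2 - b ^ 2) / 2)
  simp only [one_mul, mul_one] at hu2 hcross hγ hQ
  refine ((jacobi_energy_zero_isBigO ha hb).sub
    (((hu2.add hcross).add hγ).add hQ)).congr_left fun n => ?_
  have hn : (0 : ℝ) ≤ n := n.cast_nonneg
  have hpos : (n : ℝ) + 2 + (a + b + 1) / 2 ≠ 0 := by linarith
  have hsq := Real.sq_sqrt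
    (div_pos (jacobi_norm_pos ha hb (n + 2)) (jacobi_norm_pos ha hb (n + 1))).le
  -- This coefficient is exactly `2 ν`, so the squared derivative term contributes `4 γ` times the
  -- previous squared value, where `γ → 1 / 4` is the norm ratio.
  rw [h, show 2 * (n : ℝ) + a + b + 5 = 2 * (n + 2 + (a + b + 1) / 2) by ring, ← add_assoc]
  generalize (n : ℝ) + 2 + (a + b + 1) / 2 = ν at *
  rw [← hsq, Real.sqrt_sq (Real.sqrt_nonneg _)]
  field_simp
  ring

/-- The diagonal value at the origin of the scaled Christoffel-Darboux kernel. -/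
theorem jacobi_casorati_isBigO :
    (fun n : ℕ => √(𝗁 (n + 2) / 𝗁 (n + 1)) *
      (jacobiValueZero ha hb (n + 1) * (jacobiDerivZero ha hb (n + 2) / (n + 2)) -
        jacobiValueZero ha hb (n + 2) * (jacobiDerivZero ha hb (n + 1) / (n + 2))) - 1 / Real.pi)
      =O[atTop] fun n : ℕ => (n : ℝ)⁻¹ := by
  have hA := isBigO_jacobiValueZero ha hb 2
  have hA' := isBigO_jacobiValueZero ha hb 1
  have hg := isBigO_sqrt_jacobi_ratio ha hb
  have h1 := (hg.mul hA').mul (jacobi_scaled_deriv_up ha hb)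
  have h2 := (hg.mul hA).mul (jacobi_scaled_deriv_down ha hb)
  have h3 := (isBigO_mul_sub_const (jacobi_ratio_isBigO ha hb)
    (jacobi_sum_sq_isBigO ha hb)).const_mul_left 2
  simp only [one_mul] at h1 h2
  -- Substituting the scaled derivatives leaves `2 γ` times the sum of two squares, with limit `2 ·
  -- (1 / 4) · (2 / π)`.
  refine ((h1.sub h2).add h3).congr_left fun n => ?_
  have hsq := Real.sq_sqrt
    (div_pos (jacobi_norm_pos ha hb (n + 2)) (jacobi_norm_pos ha hb (n + 1))).le
  generalize jacobiDerivZero ha hb (n + 2) / (n + 2) = B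
  generalize jacobiDerivZero ha hb (n + 1) / (n + 2) = B'
  rw [← hsq, Real.sqrt_sq (Real.sqrt_nonneg _)]
  ring

end JacobiAsymptotics

/-! ### Perturbed oscillators and their Casorati determinants. -/

section LocalApproximation

/-- A function with `f'' + f` small relative to `|f| + |f'|` is close, together with its
derivative, to a trigonometric function. -/
theorem approx_of_perturbed_oscillator {f f1 f2 : ℝ → ℝ} {R ε : ℝ} (hR : 0 ≤ R) (hε : 0 ≤ ε)
    (hεR : 4 * (ε * R) ≤ 1) (hf : ∀ x, HasDerivAt f (f1 x) x) (hf1 : ∀ x, HasDerivAt f1 (f2 x) x)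
    (h : ∀ x, |x| ≤ R → |f2 x + f x| ≤ ε * (|f x| + |f1 x|)) {x : ℝ} (hx : |x| ≤ R) :
    |f x - (f 0 * Real.cos x + f1 0 * Real.sin x)| ≤ 4 * (ε * R) * (|f 0| + |f1 0|) ∧
    |f1 x - (f1 0 * Real.cos x - f 0 * Real.sin x)| ≤ 4 * (ε * R) * (|f 0| + |f1 0|) := by
  -- Variation of constants: `z` is constant for an exact oscillator, and in general `z' = i (f'' +
  -- f) e^(ix)`.
  set z : ℝ → ℂ := fun x => (f x + f1 x * Complex.I) * Complex.exp (x * Complex.I) with hz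
  have hexp : ∀ x : ℝ, ‖Complex.exp (x * Complex.I)‖ = 1 := Complex.norm_exp_ofReal_mul_I
  have hnorm : ∀ x, ‖z x‖ = ‖(f x + f1 x * Complex.I : ℂ)‖ := fun x => by
    simp only [hz, norm_mul, hexp, mul_one]
  have hre : ∀ x, |f x| ≤ ‖z x‖ := fun x => by
    rw [hnorm]
    have := Complex.abs_re_le_norm (f x + f1 x * Complex.I : ℂ)
    simpa using this
  have him : ∀ x, |f1 x| ≤ ‖z x‖ := fun x => by
    rw [hnorm]
    have := Complex.abs_im_le_norm (f x + f1 x * Complex.I : ℂ)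
    simpa using this
  have hz0 : ‖z 0‖ ≤ |f 0| + |f1 0| := by
    rw [hnorm]
    refine (norm_add_le _ _).trans ?_
    simp
  have hd : ∀ x, HasDerivAt z ((f2 x + f x) * Complex.I * Complex.exp (x * Complex.I)) x := by
    intro x
    have e := ((hf x).ofReal_comp.add ((hf1 x).ofReal_comp.mul_const Complex.I)).mul
      (((hasDerivAt_id x).ofReal_comp.mul_const Complex.I).cexp)
    refine e.congr_deriv ?_
    simp only [id, Complex.ofReal_one, one_mul, Pi.add_apply]
    linear_combination (f1 x : ℂ) * Complex.exp (x * Complex.I) * Complex.I_mul_I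
  have hcont : Continuous z := continuous_iff_continuousAt.2 fun x => (hd x).continuousAt
  have h0 : (0 : ℝ) ∈ Set.Icc (-R) R := ⟨by linarith, hR⟩
  obtain ⟨t, ht, hmax⟩ := isCompact_Icc.exists_isMaxOn ⟨0, h0⟩ hcont.norm.continuousOn
  have hbd : ∀ y ∈ Set.Icc (-R) R, ‖z y - z 0‖ ≤ 2 * ε * ‖z t‖ * R := by
    intro y hy
    have hb := Convex.norm_image_sub_le_of_norm_hasDerivWithin_le (s := Set.Icc (-R) R)
      (f := z) (C := 2 * ε * ‖z t‖) (fun x _ => (hd x).hasDerivWithinAt)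
      (fun x hx => by
        rw [norm_mul, norm_mul, hexp, Complex.norm_I, mul_one, mul_one, ← Complex.ofReal_add,
          Complex.norm_real, Real.norm_eq_abs]
        have h1 := h x (abs_le.2 hx)
        have h2 : ‖z x‖ ≤ ‖z t‖ := hmax hx
        have h3 := mul_le_mul_of_nonneg_left
          (add_le_add ((hre x).trans h2) ((him x).trans h2)) hε
        linarith) (convex_Icc (-R) R) h0 hy
    refine hb.trans ?_
    rw [sub_zero, Real.norm_eq_abs]
    exact mul_le_mul_of_nonneg_left (abs_le.2 hy) (by positivity)
  -- The maximum bounds its own increment; `4 ε R ≤ 1` lets half of it be absorbed.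
  have hM : ‖z t‖ ≤ 2 * ‖z 0‖ := by
    have h1 := hbd t ht
    have h2 := norm_sub_norm_le (z t) (z 0)
    nlinarith [norm_nonneg (z t)]
  have hfin : ‖z x - z 0‖ ≤ 4 * (ε * R) * (|f 0| + |f1 0|) := by
    refine (hbd x (abs_le.1 hx)).trans ?_
    have h1 : ‖z t‖ ≤ 2 * (|f 0| + |f1 0|) := by linarith
    have h2 : 0 ≤ ε * R := mul_nonneg hε hR
    nlinarith [mul_le_mul_of_nonneg_left h1 h2]
  have hrot : ‖(z x - z 0) * Complex.exp ((-x : ℝ) * Complex.I)‖ ≤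
      4 * (ε * R) * (|f 0| + |f1 0|) := by rwa [norm_mul, hexp, mul_one]
  have hval : (z x - z 0) * Complex.exp ((-x : ℝ) * Complex.I) =
      ((f x - (f 0 * Real.cos x + f1 0 * Real.sin x) : ℝ) : ℂ) +
      ((f1 x - (f1 0 * Real.cos x - f 0 * Real.sin x) : ℝ) : ℂ) * Complex.I := by
    have e1 : Complex.exp (x * Complex.I) * Complex.exp ((-x : ℝ) * Complex.I) = 1 := by
      rw [← Complex.exp_add]; simp
    have e2 : Complex.exp ((-x : ℝ) * Complex.I) = Real.cos x - Real.sin x * Complex.I := by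
      rw [Complex.exp_mul_I]; simp; ring
    have e3 : z 0 = f 0 + f1 0 * Complex.I := by simp [hz]
    rw [sub_mul, hz]
    simp only
    rw [mul_assoc, e1]
    change _ - z 0 * _ = _
    rw [e2, e3]
    push_cast
    linear_combination (f1 0 : ℂ) * Complex.sin x * Complex.I_mul_I
  rw [hval] at hrot
  have hparts : ∀ u v K : ℝ, ‖(u : ℂ) + (v : ℂ) * Complex.I‖ ≤ K → |u| ≤ K ∧ |v| ≤ K := by
    intro u v K huv
    have h1 := (Complex.abs_re_le_norm _).trans huv
    have h2 := (Complex.abs_im_le_norm _).trans huv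
    exact ⟨by simpa using h1, by simpa using h2⟩
  exact hparts _ _ _ hrot

/-- The Casorati determinant of two functions that are `C¹`-close to trigonometric functions. -/
theorem casorati_approx {f g f1 g1 : ℝ → ℝ} {R δ m A B A' B' : ℝ}
    (hf : ∀ x, HasDerivAt f (f1 x) x) (hg : ∀ x, HasDerivAt g (g1 x) x) (hδ1 : δ ≤ 1)
    (hm : |A| + |B| ≤ m) (hm' : |A'| + |B'| ≤ m)
    (h1 : ∀ x, |x| ≤ R → |f x - (A * Real.cos x + B * Real.sin x)| ≤ δ ∧
      |f1 x - (B * Real.cos x - A * Real.sin x)| ≤ δ)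
    (h2 : ∀ x, |x| ≤ R → |g x - (A' * Real.cos x + B' * Real.sin x)| ≤ δ ∧
      |g1 x - (B' * Real.cos x - A' * Real.sin x)| ≤ δ)
    {x y : ℝ} (hx : |x| ≤ R) (hy : |y| ≤ R) :
    |f x * g y - g x * f y - (A' * B - A * B') * Real.sin (x - y)| ≤
      4 * δ * (m + 1) * |x - y| := by
  have hδ : 0 ≤ δ := (abs_nonneg _).trans (h1 x hx).1
  have trig : ∀ (A B : ℝ) (x : ℝ), |A * Real.cos x + B * Real.sin x| ≤ |A| + |B| := by
    intro A B x
    refine (abs_add_le _ _).trans ?_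
    rw [abs_mul, abs_mul]
    exact add_le_add (mul_le_of_le_one_right (abs_nonneg _) (Real.abs_cos_le_one x))
      (mul_le_of_le_one_right (abs_nonneg _) (Real.abs_sin_le_one x))
  have dtrig : ∀ (A B : ℝ) (x : ℝ), HasDerivAt (fun x => A * Real.cos x + B * Real.sin x)
      (B * Real.cos x + (-A) * Real.sin x) x := by
    intro A B x
    refine (((Real.hasDerivAt_cos x).const_mul A).add
      ((Real.hasDerivAt_sin x).const_mul B)).congr_deriv ?_
    ring
  have lip : ∀ A B : ℝ, |(A * Real.cos x + B * Real.sin x) - (A * Real.cos y + B * Real.sin y)| ≤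
      (|A| + |B|) * |x - y| := by
    intro A B
    have := Convex.norm_image_sub_le_of_norm_hasDerivWithin_le (s := Set.univ) (C := |A| + |B|)
      (fun x _ => (dtrig A B x).hasDerivWithinAt)
      (fun x _ => by
        rw [Real.norm_eq_abs]
        refine (trig _ _ x).trans ?_
        rw [abs_neg, add_comm]) convex_univ (Set.mem_univ y) (Set.mem_univ x)
    simpa only [Real.norm_eq_abs] using this
  -- Closeness of the derivatives makes the error `δ`-Lipschitz; this is the source of the factor
  -- `|x - y|`.
  have lipD : ∀ (f f1 : ℝ → ℝ) (A B : ℝ), (∀ x, HasDerivAt f (f1 x) x) →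
      (∀ x, |x| ≤ R → |f x - (A * Real.cos x + B * Real.sin x)| ≤ δ ∧
        |f1 x - (B * Real.cos x - A * Real.sin x)| ≤ δ) →
      |(f x - (A * Real.cos x + B * Real.sin x)) - (f y - (A * Real.cos y + B * Real.sin y))| ≤
        δ * |x - y| := by
    intro f f1 A B hf h
    have := Convex.norm_image_sub_le_of_norm_hasDerivWithin_le (s := Set.Icc (-R) R) (C := δ)
      (fun x _ => ((hf x).sub (dtrig A B x)).hasDerivWithinAt)
      (fun x hx => by
        rw [Real.norm_eq_abs, neg_mul, ← sub_eq_add_neg]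
        exact (h x (abs_le.2 hx)).2) (convex_Icc (-R) R) (abs_le.1 hy) (abs_le.1 hx)
    simpa only [Real.norm_eq_abs, Pi.sub_apply] using this
  have lf := lipD f f1 A B hf h1
  have lg := lipD g g1 A' B' hg h2
  have bf := (h1 y hy).1
  have bg := (h2 y hy).1
  have l0 := lip A B
  have l0' := lip A' B'
  have t0 := trig A B y
  have t0' := trig A' B' y
  have hsin := Real.sin_sub x y
  set f0x := A * Real.cos x + B * Real.sin x with hf0x
  set f0y := A * Real.cos y + B * Real.sin y with hf0y
  set g0x := A' * Real.cos x + B' * Real.sin x with hg0x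
  set g0y := A' * Real.cos y + B' * Real.sin y with hg0y
  have hfy : |f y| ≤ m + 1 := by
    have := abs_add_le (f y - f0y) f0y
    rw [sub_add_cancel] at this
    linarith
  have hgy : |g y| ≤ m + 1 := by
    have := abs_add_le (g y - g0y) g0y
    rw [sub_add_cancel] at this
    linarith
  -- The determinant equals `(f x - f y) g y - (g x - g y) f y`, so every error term contains an
  -- increment from `y` to `x`.
  have key : f x * g y - g x * f y - (A' * B - A * B') * Real.sin (x - y) =
      ((f x - f0x) - (f y - f0y)) * g y + (f0x - f0y) * (g y - g0y) +
      (-(((g x - g0x) - (g y - g0y)) * f y) + -((g0x - g0y) * (f y - f0y))) := by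
    rw [hsin, hf0x, hf0y, hg0x, hg0y]
    ring
  have hxy := abs_nonneg (x - y)
  have hm0 : 0 ≤ m := (add_nonneg (abs_nonneg _) (abs_nonneg _)).trans hm
  have p1 := mul_le_mul lf hgy (abs_nonneg _) (mul_nonneg hδ hxy)
  have p2 := mul_le_mul (l0.trans (mul_le_mul_of_nonneg_right hm hxy)) bg (abs_nonneg _)
    (mul_nonneg hm0 hxy)
  have p3 := mul_le_mul lg hfy (abs_nonneg _) (mul_nonneg hδ hxy)
  have p4 := mul_le_mul (l0'.trans (mul_le_mul_of_nonneg_right hm' hxy)) bf (abs_nonneg _)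
    (mul_nonneg hm0 hxy)
  rw [← abs_mul] at p1 p2 p3 p4
  rw [key]
  refine (abs_add_le _ _).trans ((add_le_add (abs_add_le _ _) (abs_add_le _ _)).trans ?_)
  rw [abs_neg, abs_neg]
  nlinarith [mul_nonneg hδ hxy]

/-- Near the origin, a scaled solution of the Jacobi equation is a perturbed oscillator. -/
theorem jacobi_perturbed_oscillator {a b Λ c N R : ℝ} {p : ℝ[X]}
    (hp : jacobiOperator a b p = -(C Λ * p)) (hN : 1 ≤ N) (hNR : 2 * R ≤ N)
    (hΛ : |N ^ 2 - Λ| ≤ c * N) {x : ℝ} (hx : |x| ≤ R) :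
    |(derivative (derivative p)).eval (x / N) / N ^ 2 + p.eval (x / N)| ≤
      2 * (R ^ 2 + c + |b - a| + |a + b + 2|) / N *
        (|p.eval (x / N)| + |(derivative p).eval (x / N) / N|) := by
  have hN0 : 0 < N := by linarith
  have hR : 0 ≤ R := (abs_nonneg x).trans hx
  have hode := congrArg (eval (x / N)) hp
  simp only [jacobiOperator, eval_add, eval_mul, eval_sub, eval_one, eval_pow, eval_X, eval_C,
    eval_neg] at hode
  generalize eval (x / N) (derivative (derivative p)) = p2 at *
  generalize eval (x / N) (derivative p) = p1 at *
  generalize eval (x / N) p = p0 at *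
  have hxN : |x / N| ≤ 1 / 2 := by
    rw [abs_div, abs_of_pos hN0, div_le_iff₀ hN0]; linarith
  have hx2 : (x / N) ^ 2 ≤ 1 / 4 := by
    rw [← sq_abs]; nlinarith [abs_nonneg (x / N)]
  have hxR : (x / N) ^ 2 ≤ R ^ 2 / N := by
    rw [div_pow, ← sq_abs x]
    refine div_le_div₀ (by positivity) (pow_le_pow_left₀ (abs_nonneg _) hx 2) hN0 ?_
    nlinarith
  set σ := 1 - (x / N) ^ 2 with hσ
  -- Since `|x / N| ≤ 1 / 2`, dividing the equation by `σ` costs less than the factor `2` in the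
  -- claim.
  have hσ0 : 3 / 4 ≤ σ := by linarith
  have e : σ * (p2 / N ^ 2 + p0) = (-((x / N) ^ 2) + (N ^ 2 - Λ) / N ^ 2) * p0 +
      -((b - a - (a + b + 2) * (x / N)) / N) * (p1 / N) := by
    rw [hσ] at hode ⊢
    rw [show p2 / N ^ 2 = p2 * (1 / N ^ 2) by ring]
    have : (N ^ 2 - Λ) / N ^ 2 = 1 - Λ * (1 / N ^ 2) := by field_simp
    rw [this]
    have : -((b - a - (a + b + 2) * (x / N)) / N) * (p1 / N) =
      -((b - a - (a + b + 2) * (x / N)) * p1) * (1 / N ^ 2) := by field_simp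
    rw [this]
    linear_combination (1 / N ^ 2) * hode
  have b1 : |(-((x / N) ^ 2) + (N ^ 2 - Λ) / N ^ 2)| ≤ (R ^ 2 + c) / N := by
    refine (abs_add_le _ _).trans ?_
    rw [abs_neg, abs_of_nonneg (sq_nonneg (x / N)), abs_div, abs_of_pos (pow_pos hN0 2), add_div]
    refine add_le_add hxR ?_
    rw [div_le_div_iff₀ (pow_pos hN0 2) hN0]
    nlinarith
  have b2 : |-((b - a - (a + b + 2) * (x / N)) / N)| ≤ (|b - a| + |a + b + 2|) / N := by
    rw [abs_neg, abs_div, abs_of_pos hN0]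
    refine div_le_div_of_nonneg_right ((abs_sub _ _).trans ?_) hN0.le
    rw [abs_mul]
    nlinarith [abs_nonneg (a + b + 2)]
  have hc : 0 ≤ c := by
    have := (abs_nonneg _).trans hΛ
    exact nonneg_of_mul_nonneg_left this hN0
  set κ := R ^ 2 + c + |b - a| + |a + b + 2| with hκ
  have c1 : (R ^ 2 + c) / N ≤ κ / N := by
    refine div_le_div_of_nonneg_right ?_ hN0.le
    linarith [abs_nonneg (b - a), abs_nonneg (a + b + 2)]
  have c2 : (|b - a| + |a + b + 2|) / N ≤ κ / N := by
    refine div_le_div_of_nonneg_right ?_ hN0.le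
    nlinarith
  have hbound : σ * |p2 / N ^ 2 + p0| ≤ κ / N * (|p0| + |p1 / N|) := by
    rw [← abs_of_pos (show 0 < σ by linarith), ← abs_mul, e, mul_add]
    refine (abs_add_le _ _).trans (add_le_add ?_ ?_)
    · rw [abs_mul]; exact mul_le_mul_of_nonneg_right (b1.trans c1) (abs_nonneg _)
    · rw [abs_mul]; exact mul_le_mul_of_nonneg_right (b2.trans c2) (abs_nonneg _)
  have : 2 * κ / N = 2 * (κ / N) := by ring
  rw [this]
  nlinarith [abs_nonneg (p2 / N ^ 2 + p0)]

end LocalApproximation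

/-! ### From the local approximation to the sine kernel. -/

section SineKernelLimit

open Filter Asymptotics Topology

variable {a b : ℝ} (ha : -1 < a) (hb : -1 < b)

local notation "𝖯" => monicOrthogonal (jacobiFunctional ha hb)
local notation "𝗁" => orthogonalNormSq (jacobiFunctional ha hb)

/-- Near the origin, a scaled orthonormal Jacobi polynomial is trigonometric to first order. -/
theorem jacobi_scaled_approx (k : ℕ) {N R c : ℝ} (hN : 1 ≤ N) (hR : 0 ≤ R) (hNR : 2 * R ≤ N)
    (hΛ : |N ^ 2 - k * (k + a + b + 1)| ≤ c * N)
    (hsmall : 8 * (R ^ 2 + c + |b - a| + |a + b + 2|) * R ≤ N) {x : ℝ} (hx : |x| ≤ R) :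
    |(𝖯 k).eval (x / N) / √(𝗁 k) - (jacobiValueZero ha hb k * Real.cos x +
      jacobiDerivZero ha hb k / N * Real.sin x)| ≤
      8 * (R ^ 2 + c + |b - a| + |a + b + 2|) * R / N *
        (|jacobiValueZero ha hb k| + |jacobiDerivZero ha hb k / N|) ∧
    |(derivative (𝖯 k)).eval (x / N) / √(𝗁 k) / N - (jacobiDerivZero ha hb k / N * Real.cos x -
      jacobiValueZero ha hb k * Real.sin x)| ≤
      8 * (R ^ 2 + c + |b - a| + |a + b + 2|) * R / N *
        (|jacobiValueZero ha hb k| + |jacobiDerivZero ha hb k / N|) := by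
  have hN0 : 0 < N := by linarith
  have hs := Real.sqrt_pos.2 (jacobi_norm_pos ha hb k)
  have hc : 0 ≤ c := nonneg_of_mul_nonneg_left ((abs_nonneg _).trans hΛ) hN0
  have hd : ∀ (q : ℝ[X]) (x : ℝ), HasDerivAt (fun x => q.eval (x / N))
      ((derivative q).eval (x / N) / N) x := by
    intro q x
    have := (q.hasDerivAt (x / N)).comp x ((hasDerivAt_id x).div_const N)
    exact this.congr_deriv (by ring)
  set κ := R ^ 2 + c + |b - a| + |a + b + 2| with hκ
  have hκ0 : 0 ≤ κ := by positivity
  have h := approx_of_perturbed_oscillator (f := fun x => (𝖯 k).eval (x / N) / √(𝗁 k))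
    (f1 := fun x => (derivative (𝖯 k)).eval (x / N) / √(𝗁 k) / N)
    (f2 := fun x => (derivative (derivative (𝖯 k))).eval (x / N) / √(𝗁 k) / N ^ 2)
    (ε := 2 * κ / N) hR (by positivity)
    (by rw [div_mul_eq_mul_div, mul_div_assoc', div_le_one hN0]; linarith)
    (fun x => ((hd _ x).div_const _).congr_deriv (by ring))
    (fun x => (((hd _ x).div_const _).div_const _).congr_deriv (by ring))
    (fun x hx => by
      have h := jacobi_perturbed_oscillator (jacobi_ode ha hb k) hN hNR hΛ hx
      rw [← hκ] at h
      have e1 : (derivative (derivative (𝖯 k))).eval (x / N) / √(𝗁 k) / N ^ 2 +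
          (𝖯 k).eval (x / N) / √(𝗁 k) = ((derivative (derivative (𝖯 k))).eval (x / N) / N ^ 2 +
          (𝖯 k).eval (x / N)) / √(𝗁 k) := by ring
      have e2 : (derivative (𝖯 k)).eval (x / N) / √(𝗁 k) / N =
          (derivative (𝖯 k)).eval (x / N) / N / √(𝗁 k) := by ring
      rw [e1, e2, abs_div, abs_div, abs_div _ (√(𝗁 k)), abs_of_pos hs, ← add_div, mul_div_assoc']
      exact div_le_div_of_nonneg_right h hs.le) hx
  have e : 4 * (2 * κ / N * R) = 8 * κ * R / N := by ring
  simp only [zero_div, e] at h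
  exact h

/-- The Casorati determinant of two consecutive orthonormal Jacobi polynomials near the origin. -/
theorem jacobi_casorati_approx (R : ℝ) (hR : 0 ≤ R) :
    ∃ K : ℝ, 0 ≤ K ∧ ∀ᶠ n : ℕ in atTop, ∀ x y : ℝ, |x| ≤ R → |y| ≤ R →
      |(𝖯 (n + 2)).eval (x / (n + 2)) / √(𝗁 (n + 2)) *
          ((𝖯 (n + 1)).eval (y / (n + 2)) / √(𝗁 (n + 1))) -
        (𝖯 (n + 1)).eval (x / (n + 2)) / √(𝗁 (n + 1)) *
          ((𝖯 (n + 2)).eval (y / (n + 2)) / √(𝗁 (n + 2))) -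
        (jacobiValueZero ha hb (n + 1) * (jacobiDerivZero ha hb (n + 2) / (n + 2)) -
          jacobiValueZero ha hb (n + 2) * (jacobiDerivZero ha hb (n + 1) / (n + 2))) *
          Real.sin (x - y)| ≤ K / (n + 2) * |x - y| := by
  obtain ⟨M, hM⟩ := exists_abs_jacobiValueZero_le ha hb
  have hg := isBigO_sqrt_jacobi_ratio ha hb
  have hB : (fun n : ℕ => jacobiDerivZero ha hb (n + 2) / (n + 2)) =O[atTop]
      fun _ => (1 : ℝ) := by
    have h := ((jacobi_scaled_deriv_up ha hb).trans isBigO_inv_nat_one).add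
      ((hg.mul (isBigO_jacobiValueZero ha hb 1)).const_mul_left 2 |>.trans
        (by simpa using isBigO_refl (fun _ : ℕ => (1 : ℝ)) atTop))
    simpa using h
  have hB' : (fun n : ℕ => jacobiDerivZero ha hb (n + 1) / (n + 2)) =O[atTop]
      fun _ => (1 : ℝ) := by
    have h := ((jacobi_scaled_deriv_down ha hb).trans isBigO_inv_nat_one).sub
      ((hg.mul (isBigO_jacobiValueZero ha hb 2)).const_mul_left 2 |>.trans
        (by simpa using isBigO_refl (fun _ : ℕ => (1 : ℝ)) atTop))
    simpa using h
  obtain ⟨c1, hc1, hb1⟩ := hB.exists_pos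
  obtain ⟨c2, hc2, hb2⟩ := hB'.exists_pos
  have hM0 : 0 ≤ M := (abs_nonneg _).trans (hM 0)
  set m := M + c1 + c2 with hm
  -- One constant serves the degrees `n + 2` and `n + 1`, both rescaled by `N = n + 2`.
  set c := |a + b + 1| + |a + b - 1| + |a + b| with hc
  set κ := R ^ 2 + c + |b - a| + |a + b + 2| with hκ
  have hκ0 : 0 ≤ κ := by positivity
  have hm0 : 0 ≤ m := by positivity
  refine ⟨4 * (8 * κ * R * m) * (m + 1), by positivity, ?_⟩
  filter_upwards [hb1.bound, hb2.bound,
    tendsto_natCast_atTop_atTop.eventually_ge_atTop (2 * R),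
    tendsto_natCast_atTop_atTop.eventually_ge_atTop (8 * κ * R),
    tendsto_natCast_atTop_atTop.eventually_ge_atTop (8 * κ * R * m)] with n h1 h2 h3 h4 h5 x y hx hy
  rw [norm_one, mul_one, Real.norm_eq_abs] at h1 h2
  have hn : (0 : ℝ) ≤ n := n.cast_nonneg
  have hN : (1 : ℝ) ≤ n + 2 := by linarith
  have hN0 : (0 : ℝ) < n + 2 := by linarith
  have hΛ2 : |((n : ℝ) + 2) ^ 2 - (n + 2 : ℕ) * ((n + 2 : ℕ) + a + b + 1)| ≤ c * (n + 2) := by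
    push_cast
    rw [show ((n : ℝ) + 2) ^ 2 - (n + 2) * (n + 2 + a + b + 1) = -((a + b + 1) * (n + 2)) by ring,
      abs_neg, abs_mul, abs_of_pos hN0]
    refine mul_le_mul_of_nonneg_right ?_ hN0.le
    linarith [abs_nonneg (a + b - 1), abs_nonneg (a + b)]
  have hΛ1 : |((n : ℝ) + 2) ^ 2 - (n + 1 : ℕ) * ((n + 1 : ℕ) + a + b + 1)| ≤ c * (n + 2) := by
    push_cast
    rw [show ((n : ℝ) + 2) ^ 2 - (n + 1) * (n + 1 + a + b + 1) =
      -((a + b - 1) * (n + 2)) + (a + b) by ring]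
    refine (abs_add_le _ _).trans ?_
    rw [abs_neg, abs_mul, abs_of_pos hN0]
    nlinarith [abs_nonneg (a + b + 1), abs_nonneg (a + b)]
  have hd : ∀ (k : ℕ) (x : ℝ), HasDerivAt (fun x => (𝖯 k).eval (x / ((n : ℝ) + 2)) / √(𝗁 k))
      ((derivative (𝖯 k)).eval (x / ((n : ℝ) + 2)) / √(𝗁 k) / (n + 2)) x := by
    intro k x
    have := (((𝖯 k).hasDerivAt (x / ((n : ℝ) + 2))).comp x
      ((hasDerivAt_id x).div_const ((n : ℝ) + 2))).div_const (√(𝗁 k))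
    exact this.congr_deriv (by ring)
  have hcoef : 0 ≤ 8 * κ * R / ((n : ℝ) + 2) := by positivity
  have hmf : |jacobiValueZero ha hb (n + 2)| + |jacobiDerivZero ha hb (n + 2) / (n + 2)| ≤ m := by
    linarith [hM (n + 2)]
  have hmg : |jacobiValueZero ha hb (n + 1)| + |jacobiDerivZero ha hb (n + 1) / (n + 2)| ≤ m := by
    linarith [hM (n + 1)]
  have key := casorati_approx (R := R) (δ := 8 * κ * R / (n + 2) * m) (m := m)
    (hd (n + 2)) (hd (n + 1))
    (by rw [div_mul_eq_mul_div, div_le_one hN0]; linarith) hmf hmg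
    (fun x hx => by
      have h := jacobi_scaled_approx ha hb (n + 2) hN hR (by linarith) hΛ2 (by linarith) hx
      have h' := mul_le_mul_of_nonneg_left hmf hcoef
      exact ⟨h.1.trans h', h.2.trans h'⟩)
    (fun x hx => by
      have h := jacobi_scaled_approx ha hb (n + 1) hN hR (by linarith) hΛ1 (by linarith) hx
      have h' := mul_le_mul_of_nonneg_left hmg hcoef
      exact ⟨h.1.trans h', h.2.trans h'⟩) hx hy
  refine key.trans (le_of_eq ?_)
  ring

/-- The polynomial part of the scaled kernel converges to the sine kernel at rate `1 / N`. -/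
theorem jacobi_polynomial_kernel_approx (R : ℝ) (hR : 0 ≤ R) :
    ∃ K : ℝ, 0 ≤ K ∧ ∀ᶠ n : ℕ in atTop, ∀ x y : ℝ, |x| < R → |y| < R →
      |(∑ j ∈ Finset.range (n + 2), (𝖯 j).eval (x / (n + 2)) * (𝖯 j).eval (y / (n + 2)) / 𝗁 j) /
        (n + 2) - Real.sinc (x - y) / Real.pi| ≤ K / (n + 2) := by
  obtain ⟨K, hK0, hK⟩ := jacobi_casorati_approx ha hb R hR
  obtain ⟨c1, hc1, hb1⟩ := (isBigO_sqrt_jacobi_ratio ha hb).exists_pos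
  obtain ⟨c2, hc2, hb2⟩ := (jacobi_casorati_isBigO ha hb).exists_pos
  refine ⟨c1 * K + 3 * c2, by positivity, ?_⟩
  filter_upwards [hK, hb1.bound, hb2.bound, eventually_gt_atTop 0] with n hn h1 h2 hn0 x y hx hy
  rw [norm_one, mul_one, Real.norm_of_nonneg (Real.sqrt_nonneg _)] at h1
  have hn0' : (1 : ℝ) ≤ n := by exact_mod_cast hn0
  rw [Real.norm_eq_abs, norm_inv, Real.norm_of_nonneg (by linarith)] at h2
  have hN0 : (0 : ℝ) < n + 2 := by linarith
  have h2' : c2 * (n : ℝ)⁻¹ ≤ 3 * c2 / (n + 2) := by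
    rw [← div_eq_mul_inv, div_le_div_iff₀ (by linarith) hN0]
    nlinarith
  have hoff : ∀ y : ℝ, |y| < R → y ≠ x →
      |(∑ j ∈ Finset.range (n + 2), (𝖯 j).eval (x / (n + 2)) * (𝖯 j).eval (y / (n + 2)) / 𝗁 j) /
        (n + 2) - Real.sinc (x - y) / Real.pi| ≤ (c1 * K + 3 * c2) / (n + 2) := by
    intro y hy hxy
    have hxy' : x - y ≠ 0 := sub_ne_zero.2 hxy.symm
    have hcd := christoffel_darboux (jacobiFunctional_pos ha hb) (n + 1) (x / (n + 2)) (y / (n + 2))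
    have hcas := hn x y hx.le hy.le
    have p1 := jacobi_norm_pos ha hb (n + 1)
    have p2 := jacobi_norm_pos ha hb (n + 2)
    have s1 := Real.sqrt_pos.2 p1
    have s2 := Real.sqrt_pos.2 p2
    set κ := jacobiValueZero ha hb (n + 1) * (jacobiDerivZero ha hb (n + 2) / (n + 2)) -
      jacobiValueZero ha hb (n + 2) * (jacobiDerivZero ha hb (n + 1) / (n + 2))
    set S := ∑ j ∈ Finset.range (n + 2),
      (𝖯 j).eval (x / (n + 2)) * (𝖯 j).eval (y / (n + 2)) / 𝗁 j
    -- Christoffel–Darboux for orthonormal polynomials; normalization produces the square root of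
    -- the norm ratio.
    have hS : S / (n + 2) * (x - y) = √(𝗁 (n + 2) / 𝗁 (n + 1)) *
        ((𝖯 (n + 2)).eval (x / (n + 2)) / √(𝗁 (n + 2)) *
          ((𝖯 (n + 1)).eval (y / (n + 2)) / √(𝗁 (n + 1))) -
        (𝖯 (n + 1)).eval (x / (n + 2)) / √(𝗁 (n + 1)) *
          ((𝖯 (n + 2)).eval (y / (n + 2)) / √(𝗁 (n + 2)))) := by
      have e : S / (n + 2) * (x - y) = S * (x / (n + 2) - y / (n + 2)) := by ring
      rw [e, hcd, Real.sqrt_div p2.le, ← Real.sq_sqrt p1.le, Real.sqrt_sq s1.le]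
      field_simp
    have hsinc : Real.sin (x - y) = Real.sinc (x - y) * (x - y) := by
      rw [Real.sinc_of_ne_zero hxy']; field_simp
    have e1 : |(S / (n + 2) - √(𝗁 (n + 2) / 𝗁 (n + 1)) * κ * Real.sinc (x - y)) * (x - y)| ≤
        c1 * K / (n + 2) * |x - y| := by
      rw [sub_mul, hS, mul_assoc (_ * κ), ← hsinc, mul_assoc, ← mul_sub, abs_mul,
        abs_of_nonneg (Real.sqrt_nonneg _), mul_div_assoc, mul_assoc c1]
      exact mul_le_mul h1 hcas (abs_nonneg _) hc1.le
    rw [abs_mul] at e1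
    have e2 := le_of_mul_le_mul_right e1 (abs_pos.2 hxy')
    have e3 : |(√(𝗁 (n + 2) / 𝗁 (n + 1)) * κ - 1 / Real.pi) * Real.sinc (x - y)| ≤
        3 * c2 / (n + 2) := by
      rw [abs_mul]
      refine (mul_le_of_le_one_right (abs_nonneg _) (Real.abs_sinc_le_one _)).trans (h2.trans h2')
    have e4 : S / (n + 2) - Real.sinc (x - y) / Real.pi =
        (S / (n + 2) - √(𝗁 (n + 2) / 𝗁 (n + 1)) * κ * Real.sinc (x - y)) +
        (√(𝗁 (n + 2) / 𝗁 (n + 1)) * κ - 1 / Real.pi) * Real.sinc (x - y) := by ring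
    rw [e4, add_div]
    exact (abs_add_le _ _).trans (add_le_add e2 e3)
  -- The diagonal bound is a limit of off-diagonal ones; the strict inequality `|x| < R` keeps
  -- nearby points admissible.
  by_cases hxy : y = x
  · have hcont : Continuous fun y : ℝ =>
        |(∑ j ∈ Finset.range (n + 2), (𝖯 j).eval (x / (n + 2)) * (𝖯 j).eval (y / (n + 2)) / 𝗁 j) /
          (n + 2) - Real.sinc (x - y) / Real.pi| := by
      have h1 : ∀ j, Continuous fun y : ℝ => (𝖯 j).eval (y / (n + 2)) :=
        fun j => (𝖯 j).continuous.comp (continuous_id.div_const _)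
      have h2 : Continuous fun y : ℝ => Real.sinc (x - y) :=
        Real.continuous_sinc.comp (continuous_const.sub continuous_id)
      fun_prop
    rw [hxy]
    refine le_of_tendsto (hcont.continuousAt.tendsto.mono_left
      (nhdsWithin_le_nhds (s := {x}ᶜ))) ?_
    have hopen : ∀ᶠ y in 𝓝[≠] x, |y| < R :=
      nhdsWithin_le_nhds ((isOpen_lt continuous_abs continuous_const).mem_nhds hx)
    filter_upwards [hopen, self_mem_nhdsWithin] with y hy hyx
    exact hoff y hy hyx
  · exact hoff y hy hxy

theorem sineKernel_eq_sinc (x y : ℝ) : sineKernel x y = Real.sinc (x - y) / Real.pi := by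
  unfold sineKernel
  split_ifs with h
  · simp [h]
  · rw [Real.sinc_of_ne_zero (sub_ne_zero.2 h), div_div, mul_comm Real.pi]

/-- The Jacobi weight is `1 + O(x)` near the origin. -/
theorem exists_abs_jacobiWeight_sub_one_le (a b : ℝ) :
    ∃ K δ : ℝ, 0 ≤ K ∧ 0 < δ ∧ ∀ x, |x| < δ → |jacobiWeight a b x - 1| ≤ K * |x| := by
  have h := (hasDerivAt_jacobiWeight a b (x := 0) (by norm_num)).isBigO_sub
  obtain ⟨K, hK, hb⟩ := h.exists_pos
  obtain ⟨δ, hδ, hball⟩ := Metric.eventually_nhds_iff.1 hb.bound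
  refine ⟨K, δ, hK.le, hδ, fun x hx => ?_⟩
  have := hball (y := x) (by simpa using hx)
  simpa [jacobiWeight] using this

end SineKernelLimit

/-! ### Uniform convergence on compact sets. -/

theorem mainTheorem5 (a b : ℝ) (ha : -1 < a) (hb : -1 < b) (K : Set ℝ) (hK : IsCompact K) :
    ∃ C : ℝ, ∃ N₀ : ℕ, ∀ N : ℕ, 0 < N → N₀ ≤ N → ∀ x ∈ K, ∀ y ∈ K,
      |1 / (N : ℝ) * jueKernel a b N (x / N) (y / N) - sineKernel x y| ≤ C / N := by
  obtain ⟨R₀, hR₀⟩ := hK.isBounded.exists_norm_le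
  set R := |R₀| + 1 with hR
  have hRpos : 0 < R := by positivity
  have hKR : ∀ x ∈ K, |x| < R := fun x hx => by
    have := hR₀ x hx
    rw [Real.norm_eq_abs] at this
    linarith [le_abs_self R₀]
  obtain ⟨A, hA0, hA⟩ := jacobi_polynomial_kernel_approx ha hb R hRpos.le
  obtain ⟨B, δ, hB0, hδ, hB⟩ := exists_abs_jacobiWeight_sub_one_le (a / 2) (b / 2)
  -- The three summands respectively put `R / N` below `δ` and make `A / N` and `B R / N` at most
  -- `1`.
  obtain ⟨n₀, hn₀⟩ := Filter.eventually_atTop.1 (hA.and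
    ((tendsto_natCast_atTop_atTop (R := ℝ)).eventually_ge_atTop (R / δ + A + B * R)))
  -- The two weight factors deviate from `1` by at most `3 B R / N` jointly, and `1 + 1` bounds the
  -- normalized polynomial kernel.
  refine ⟨A + 3 * (B * R) * (1 + 1), n₀ + 2, fun N _ hN x hx y hy => ?_⟩
  obtain ⟨n, rfl⟩ : ∃ n, N = n + 2 := ⟨N - 2, by omega⟩
  obtain ⟨hker, hlarge⟩ := hn₀ n (by omega)
  have h := hker x y (hKR x hx) (hKR y hy)
  push_cast
  rw [jueKernel_eq ha hb, sineKernel_eq_sinc]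
  have hRδ : 0 < R / δ := by positivity
  have hBR : 0 ≤ B * R := by positivity
  have hN0 : (0 : ℝ) < n + 2 := by positivity
  have hw : ∀ x ∈ K, |jacobiWeight (a / 2) (b / 2) (x / (n + 2)) - 1| ≤ B * R / (n + 2) := by
    intro x hx
    have hxN : |x / ((n : ℝ) + 2)| ≤ R / (n + 2) := by
      rw [abs_div, abs_of_pos hN0]
      exact div_le_div_of_nonneg_right (hKR x hx).le hN0.le
    have hlt : R / ((n : ℝ) + 2) < δ := by
      rw [div_lt_iff₀ hN0, ← div_lt_iff₀' hδ]; linarith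
    refine (hB _ (hxN.trans_lt hlt)).trans ?_
    rw [mul_div_assoc]
    exact mul_le_mul_of_nonneg_left hxN hB0
  have hx' := hw x hx
  have hy' := hw y hy
  have hsinc : |Real.sinc (x - y) / Real.pi| ≤ 1 := by
    rw [abs_div, abs_of_pos Real.pi_pos, div_le_one Real.pi_pos]
    linarith [Real.abs_sinc_le_one (x - y), Real.pi_gt_three]
  have hone : B * R / ((n : ℝ) + 2) ≤ 1 := by rw [div_le_one hN0]; linarith
  have hAone : A / ((n : ℝ) + 2) ≤ 1 := by rw [div_le_one hN0]; linarith
  rw [show 1 / ((n : ℝ) + 2) * (jacobiWeight (a / 2) (b / 2) (x / (n + 2)) *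
      jacobiWeight (a / 2) (b / 2) (y / (n + 2)) *
      ∑ j ∈ Finset.range (n + 2), (monicOrthogonal (jacobiFunctional ha hb) j).eval (x / (n + 2)) *
        (monicOrthogonal (jacobiFunctional ha hb) j).eval (y / (n + 2)) /
        orthogonalNormSq (jacobiFunctional ha hb) j) =
      jacobiWeight (a / 2) (b / 2) (x / (n + 2)) * jacobiWeight (a / 2) (b / 2) (y / (n + 2)) *
      ((∑ j ∈ Finset.range (n + 2), (monicOrthogonal (jacobiFunctional ha hb) j).eval (x / (n + 2)) *
        (monicOrthogonal (jacobiFunctional ha hb) j).eval (y / (n + 2)) /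
        orthogonalNormSq (jacobiFunctional ha hb) j) / (n + 2)) by ring]
  generalize (∑ j ∈ Finset.range (n + 2),
    (monicOrthogonal (jacobiFunctional ha hb) j).eval (x / (n + 2)) *
    (monicOrthogonal (jacobiFunctional ha hb) j).eval (y / (n + 2)) /
    orthogonalNormSq (jacobiFunctional ha hb) j) / ((n : ℝ) + 2) = S at *
  generalize jacobiWeight (a / 2) (b / 2) (x / (n + 2)) = u at *
  generalize jacobiWeight (a / 2) (b / 2) (y / (n + 2)) = v at *
  generalize Real.sinc (x - y) / Real.pi = T at *
  have hS : |S| ≤ 2 := by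
    have := abs_add_le (S - T) T
    rw [sub_add_cancel] at this
    linarith
  have huv : |u * v - 1| ≤ 3 * (B * R / (n + 2)) := by
    rw [show u * v - 1 = (u - 1) * (v - 1) + (u - 1) + (v - 1) by ring]
    refine (abs_add_le _ _).trans ((add_le_add_left (abs_add_le _ _) _).trans ?_)
    rw [abs_mul]
    have := mul_le_mul hx' (hy'.trans hone) (abs_nonneg _) (by positivity)
    linarith
  rw [show u * v * S - T = (S - T) + (u * v - 1) * S by ring]
  refine (abs_add_le _ _).trans ?_
  rw [abs_mul, add_div]
  refine add_le_add h ((mul_le_mul huv hS (abs_nonneg _) (by positivity)).trans (le_of_eq ?_))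
  ring
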